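/- \textbf{Setting.} A \emph{labelled graph} $(G,\ell)$ is a nonempty finite simple graph $G=(V,E)$ (not necessarily connected) together with $\ell:V\to\{0,1\}^*$; a \emph{distributed language} is a set of labelled graphs (on vertex sets $\{0,\dots,N-1\}$). Every node of an $N$-node graph has an identifier; identifiers are given by an arbitrary injective map $\mathrm{id}:V\to[1,M(N)]$, where $M:\mathbb N\to\mathbb N$ satisfies $M(N)\ge N$ and is bounded by a polynomial. A node initially knows $N$, its identifier, its label and the identifiers of its neighbours. All nodes run the same algorithm, in synchronous rounds, with unrestricted local computation; in each round every node sends a message to each of its neighbours, of arbitrary length in a LOCAL round, and of at most $c\lfloor\log_2 N\rfloor$ bits, for a constant $c$ that depends only on the algorithm, in a CONGEST round. After the last round each node accepts or rejects. A deterministic algorithm decides $\mathcal L$ if, for every $(G,\ell)$ and every identifier assignment, $(G,\ell)\in\mathcal L$ if and only if all nodes accept. A randomized algorithm decides $\mathcal L$ with error $\delta$ if, for every $(G,\ell)$ and every identifier assignment, with probability at least $1-\delta$ all nodes accept when $(G,\ell)\in\mathcal L$, and at least one node rejects when $(G,\ell)\notin\mathcal L$; nodes may use shared randomness (hence, in particular,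 private coins). Let $\mathbf{LC}$ (resp. $\mathbf{CL}$) be the class of languages decided by a deterministic algorithm performing one LOCAL round and then one CONGEST round (resp. one CONGEST round and then one LOCAL round). The language \texttt{special-disjointness} consists of the labelled graphs isomorphic to the following ones, for $n\ge1$: the graph is the union of a clique $K_n$, a path $v_1,v_2,v_3,v_4$ and two vertices $u_1,u_2$, where in addition $v_4$ is adjacent to exactly one node of the clique, and $u_1,u_2$ are pendant vertices attached to $v_1$; the labels (pairs, encoded injectively in $\{0,1\}^*$) are $(\bot,\bot)$ on the nodes of the clique, $(\bot,i)$ on $v_i$ for $i=1,2,3$, $(b,4)$ on $v_4$, $(x,\bot)$ on $u_1$ and $(y,\bot)$ on $u_2$, where $b\in\{0,1\}$ and $x,y\in\{0,1\}^n$ are such that $b=1$ if and only if $x_iy_i=0$ for all $i$. \textbf{Theorem.} $\mathbf{LC}\smallsetminus\mathbf{CL}\neq\varnothing$, and this holds even for randomized algorithms that may err with probability $\frac12-\varepsilon$, for every $\varepsilon>0$. More precisely: \begin{enumerate} \item For every such $M$, \texttt{special-disjointness} is in $\mathbf{LC}\smallsetminus\mathbf{CL}$, and for no $\delta<\frac13$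 is it decided with error $\delta$ by a randomized algorithm performing one CONGEST round and then one LOCAL round. \item There is a distributed language $\mathcal L$ such that, for every such $M$, $\mathcal L\in\mathbf{LC}\smallsetminus\mathbf{CL}$, and for no $\varepsilon>0$ is $\mathcal L$ decided with error $\frac12-\varepsilon$ by a randomized algorithm performing one CONGEST round and then one LOCAL round. \end{enumerate} -/

import Mathlib

namespace HybridModels

/-! Labelled graphs and distributed languages. -/

/-- A labelled graph `(G, ℓ)`: a nonempty finite simple graph, with vertex set `Fin order`, and a
label in `{0,1}^*` for every node. It need not be connected. -/
structure LabeledGraph where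
  order : ℕ
  order_pos : 0 < order
  graph : SimpleGraph (Fin order)
  label : Fin order → List Bool

/-- A distributed language is a collection of labelled graphs. -/
abbrev DistLanguage : Type := Set LabeledGraph

/-- `M n` is an admissible range of identifiers in `n`-node networks: there are enough
identifiers, and polynomially many. -/
def IsIdRange (M : ℕ → ℕ) : Prop :=
  (∀ n, n ≤ M n) ∧ ∃ p : Polynomial ℕ, ∀ n, M n ≤ p.eval n

/-- `id` is a one-to-one assignment of identifiers in `[1, M n]` to the nodes. -/
def IsIdAssignment (M : ℕ → ℕ) (I : LabeledGraph) (id : Fin I.order → ℕ) : Prop :=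
  Function.Injective id ∧ ∀ v, 1 ≤ id v ∧ id v ≤ M I.order

/-! Synchronous message-passing algorithms. -/

/-- What a node knows initially: the number of nodes of the network, its own identifier, the
identifiers of its neighbors, and its own label. -/
structure LocalInput where
  size : ℕ
  id : ℕ
  nbrs : Finset ℕ
  label : List Bool

/-- The messages that a node receives in one round, each with the identifier of its sender. -/
abbrev Inbox : Type := Finset (ℕ × List Bool)

/-- A deterministic algorithm, run by all nodes. The arguments of both functions are the initial
knowledge of a node and the list of its past inboxes (most recent first; its length is the number
of completed rounds). `send` also takes the identifier of the neighbor to which the message is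
addressed. Local computation is unrestricted. -/
structure Algorithm where
  send : LocalInput → List Inbox → ℕ → List Bool
  accept : LocalInput → List Inbox → Bool

open Classical in
/-- The neighbors of `v`. -/
noncomputable def neighbors (I : LabeledGraph) (v : Fin I.order) : Finset (Fin I.order) :=
  Finset.univ.filter fun w => I.graph.Adj v w

/-- The initial knowledge of `v`. -/
noncomputable def localInput (I : LabeledGraph) (id : Fin I.order → ℕ) (v : Fin I.order) :
    LocalInput where
  size := I.order
  id := id v
  nbrs := (neighbors I v).image id
  label := I.label v

/-- The inboxes of a node in the first `t` rounds of the execution of `A`, most recent first. -/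
noncomputable def history (A : Algorithm) (I : LabeledGraph) (id : Fin I.order → ℕ) :
    ℕ → Fin I.order → List Inbox
  | 0, _ => []
  | t + 1, v =>
      ((neighbors I v).image fun w =>
        (id w, A.send (localInput I id w) (history A I id t w) (id v))) :: history A I id t v

/-- The message that `v` sends to its neighbor `w` in the round that follows `t` completed
rounds. -/
noncomputable def message (A : Algorithm) (I : LabeledGraph) (id : Fin I.order → ℕ) (t : ℕ)
    (v w : Fin I.order) : List Bool :=
  A.send (localInput I id v) (history A I id t v) (id w)

/-- Node `v` accepts when `A` stops after `t` rounds. -/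
def NodeAccepts (A : Algorithm) (I : LabeledGraph) (id : Fin I.order → ℕ) (t : ℕ)
    (v : Fin I.order) : Prop :=
  A.accept (localInput I id v) (history A I id t v) = true

/-- All nodes accept when `A` stops after `t` rounds. -/
def AllAccept (A : Algorithm) (I : LabeledGraph) (id : Fin I.order → ℕ) (t : ℕ) : Prop :=
  ∀ v, NodeAccepts A I id t v

/-! Hybrid models. -/

/-- The two kinds of rounds. -/
inductive RoundKind
  | LOCAL
  | CONGEST

/-- In the rounds of kind `CONGEST` of the sequence `rounds`, every message sent along an edge of
an `n`-node network has at most `c * log₂ n` bits. There is no restriction in the rounds of kind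
`LOCAL`. -/
def RespectsBandwidth (M : ℕ → ℕ) (rounds : List RoundKind) (c : ℕ) (A : Algorithm) : Prop :=
  ∀ (I : LabeledGraph) (id : Fin I.order → ℕ), IsIdAssignment M I id →
    ∀ t : ℕ, rounds[t]? = some RoundKind.CONGEST →
      ∀ v w, I.graph.Adj v w → (message A I id t v w).length ≤ c * Nat.log 2 I.order

/-- The languages decided by a deterministic algorithm that performs the given sequence of
rounds: for every labelled graph and every assignment of identifiers, the labelled graph is in the
language if and only if all nodes accept. -/
def Decidable (M : ℕ → ℕ) (rounds : List RoundKind) : Set DistLanguage :=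
  {L | ∃ A : Algorithm, (∃ c : ℕ, RespectsBandwidth M rounds c A) ∧
    ∀ (I : LabeledGraph) (id : Fin I.order → ℕ), IsIdAssignment M I id →
      (I ∈ L ↔ AllAccept A I id rounds.length)}

/-- All messages and all decisions of the randomly chosen algorithm `A ω` are random variables. -/
def IsMeasurableAlgorithm {Ω : Type} [MeasurableSpace Ω] (M : ℕ → ℕ) (rounds : List RoundKind)
    (A : Ω → Algorithm) : Prop :=
  ∀ (I : LabeledGraph) (id : Fin I.order → ℕ), IsIdAssignment M I id →
    (∀ t < rounds.length, ∀ v w, I.graph.Adj v w → ∀ m : List Bool,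
      MeasurableSet {ω | message (A ω) I id t v w = m}) ∧
    ∀ v, MeasurableSet {ω | NodeAccepts (A ω) I id rounds.length v}

/-- The languages decided, with error probability at most `δ`, by a randomized algorithm that
performs the given sequence of rounds: a yes-instance is accepted by all nodes with probability at
least `1 - δ`, and a no-instance is rejected by at least one node with probability at least
`1 - δ`. The nodes have access to a common source of randomness `ω` of any kind. This includes
private coins: take for `ω` a family of independent sources indexed by the identifiers, where each
node only reads the one indexed by its own identifier. -/
def RandDecidable (M : ℕ → ℕ) (rounds : List RoundKind) (δ : ℝ) : Set DistLanguage :=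
  {L | ∃ (Ω : Type) (_ : MeasurableSpace Ω) (μ : MeasureTheory.Measure Ω)
      (_ : MeasureTheory.IsProbabilityMeasure μ) (A : Ω → Algorithm),
    IsMeasurableAlgorithm M rounds A ∧
    (∃ c : ℕ, ∀ ω, RespectsBandwidth M rounds c (A ω)) ∧
    ∀ (I : LabeledGraph) (id : Fin I.order → ℕ), IsIdAssignment M I id →
      (I ∈ L → 1 - δ ≤ μ.real {ω | AllAccept (A ω) I id rounds.length}) ∧
      (I ∉ L → 1 - δ ≤ μ.real {ω | ∃ v, ¬ NodeAccepts (A ω) I id rounds.length v})}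

/-- One `LOCAL` round followed by one `CONGEST` round. -/
def LC (M : ℕ → ℕ) : Set DistLanguage := Decidable M [RoundKind.LOCAL, RoundKind.CONGEST]

/-- One `CONGEST` round followed by one `LOCAL` round. -/
def CL (M : ℕ → ℕ) : Set DistLanguage := Decidable M [RoundKind.CONGEST, RoundKind.LOCAL]

/-- One `CONGEST` round followed by one `LOCAL` round, randomized with error at most `δ`. -/
def RandCL (M : ℕ → ℕ) (δ : ℝ) : Set DistLanguage :=
  RandDecidable M [RoundKind.CONGEST, RoundKind.LOCAL] δ

/-! The language `special-disjointness`. -/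

/-- The nodes: an `n`-clique, a path `v₁, v₂, v₃, v₄`, and two pendant nodes `u₁, u₂`. -/
inductive GadgetVertex (n : ℕ)
  | clique (i : Fin n)
  | v₁ | v₂ | v₃ | v₄ | u₁ | u₂

/-- The edges, in one orientation; `v₄` is attached to the clique at the node `a`. -/
def gadgetRel {n : ℕ} (a : Fin n) : GadgetVertex n → GadgetVertex n → Prop
  | .clique _, .clique _ => True
  | .v₄, .clique i => i = a
  | .v₁, .v₂ => True
  | .v₂, .v₃ => True
  | .v₃, .v₄ => True
  | .u₁, .v₁ => True
  | .u₂, .v₁ => True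
  | _, _ => False

/-- The graph: the symmetric closure of `gadgetRel a`, without loops. -/
def gadget {n : ℕ} (a : Fin n) : SimpleGraph (GadgetVertex n) :=
  SimpleGraph.fromRel (gadgetRel a)

/-- An injective encoding in `{0,1}^*` of the pairs `(s, r)`, where `s` is a binary string or `⊥`
(`none`), and `r` is in `{1, 2, 3, 4}` or `⊥` (`0`). -/
def labelCode (s : Option (List Bool)) (r : Fin 5) : List Bool :=
  List.replicate r true ++ false ::
    match s with
    | none => [false]
    | some w => true :: w

/-- The labels: `u₁` holds `x`, `u₂` holds `y`, `v₄` holds the bit `b`, and each node of the path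
holds its rank. -/
def gadgetLabel {n : ℕ} (x y : Fin n → Bool) (b : Bool) : GadgetVertex n → List Bool
  | .clique _ => labelCode none 0
  | .v₁ => labelCode none 1
  | .v₂ => labelCode none 2
  | .v₃ => labelCode none 3
  | .v₄ => labelCode (some [b]) 4
  | .u₁ => labelCode (some (List.ofFn x)) 0
  | .u₂ => labelCode (some (List.ofFn y)) 0

/-- `special-disjointness`: the labelled graphs isomorphic to a gadget where `b = 1` if and only
if `x` and `y` are disjoint. -/
def specialDisjointness : DistLanguage :=
  {I | ∃ (n : ℕ) (a : Fin n) (x y : Fin n → Bool) (b : Bool) (φ : I.graph ≃g gadget a),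
    (∀ v, I.label v = gadgetLabel x y b (φ v)) ∧
    (b = true ↔ ∀ i, ¬ (x i = true ∧ y i = true))}

end HybridModels

/-! Upper bounds. A `LOCAL` round brings both strings to `v₁`, which computes disjointness as one
bit; `v₃` reads `b`, and after the `CONGEST` round `v₂` compares the two bits. The full inputs sent
in the first round also let every node check that its view occurs in some gadget. This forces a
gadget: following the ranks from any node leads to rank `4`, hence to a whole gadget on `n + 6`
nodes, and since the number of nodes is known to be `n + 6`, nothing else is left
(`LooksLikeGadget.isGadget`).

Lower bounds. In the opposite order, let a string `x` sit at a node `src` with a single neighbour,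
and let the bit to be checked against `x i` sit at `tgt`, at distance at least `4`. After two
rounds, `src` and its neighbour know nothing of the bit, and every other node knows `x` only through
the first message of `src`, of `O(log N)` bits. For uniform `x` and `i`, a function of that message
is nearly uncorrelated with `x i` (`sum_bitSign_mul_le`), so the nodes far from `src` accept with
the right bit about as often as with the wrong one.

To turn this into an error bound, take `k` disjoint gadgets and compare the correct instance with
the `k` instances where one bit is flipped. If all nodes accept the correct instance, a flip can
only be detected far from the corresponding source. If some node rejects it, that node still rejects
after a flip in any other gadget, so at most one flipped instance can become accepted
(`sum_accAll_sub_le`). Averaging over instances and coins gives `k (1 - 2δ) ≤ δ + k η`, where `η` is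
the correlation bound (`error_bound`). One gadget gives the threshold `1/3` for
`specialDisjointness`; letting `k` grow gives `1/2`, for the language `agreement`, which allows
disjoint unions. -/

namespace HybridModels

/-! ### Correlation of a short message with a random bit -/

/-- The sign of a bit. -/
def bitSign (b : Bool) : ℝ := if b then 1 else -1

/-- The bits are independent, so the exponential moment factors, and each factor is `2 cosh (t h
i)`, bounded through `cosh u ≤ exp (u² / 2)`. -/
theorem sum_exp_bitSign_le {n : ℕ} (h : Fin n → ℝ) (hh : ∀ i, |h i| ≤ 1) (t : ℝ) :
    ∑ x : Fin n → Bool, Real.exp (t * ∑ i, bitSign (x i) * h i) ≤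
      2 ^ n * Real.exp (t ^ 2 * n / 2) := by
  have h1 : ∀ x : Fin n → Bool, Real.exp (t * ∑ i, bitSign (x i) * h i) =
      ∏ i, Real.exp (t * (bitSign (x i) * h i)) := fun x => by
    rw [Finset.mul_sum, Real.exp_sum]
  have h2 : ∀ i, ∑ b : Bool, Real.exp (t * (bitSign b * h i)) ≤ 2 * Real.exp (t ^ 2 / 2) := by
    intro i
    have h3 := Real.cosh_le_exp_half_sq (t * h i)
    rw [Real.cosh_eq] at h3
    have h4 : (t * h i) ^ 2 / 2 ≤ t ^ 2 / 2 := by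
      have := (sq_le_one_iff_abs_le_one (h i)).2 (hh i)
      nlinarith [sq_nonneg t]
    have h5 := Real.exp_le_exp.2 h4
    simp only [Fintype.sum_bool, bitSign, if_true, Bool.false_eq_true, if_false, one_mul, neg_mul,
      mul_neg]
    linarith
  simp_rw [h1]
  rw [← Fintype.prod_sum (fun i b => Real.exp (t * (bitSign b * h i)))]
  calc ∏ i, ∑ b : Bool, Real.exp (t * (bitSign b * h i))
      ≤ ∏ _i : Fin n, 2 * Real.exp (t ^ 2 / 2) :=
        Finset.prod_le_prod (fun i _ => Finset.sum_nonneg fun b _ => (Real.exp_pos _).le)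
          fun i _ => h2 i
    _ = 2 ^ n * Real.exp (t ^ 2 * n / 2) := by
        rw [Finset.prod_const, Finset.card_univ, Fintype.card_fin, mul_pow, ← Real.exp_nat_mul]
        congr 2
        ring

/-- If `h x` depends on `x` only through a message `s x` that takes at most `K` values, then `h x`
has a small correlation with the bits of a uniformly random `x`. -/
theorem sum_bitSign_mul_le {n K : ℕ} {S : Type*} [DecidableEq S] (s : (Fin n → Bool) → S)
    (hK : (Finset.univ.image s).card ≤ K) (h : (Fin n → Bool) → Fin n → ℝ)
    (hs : ∀ x x', s x = s x' → h x = h x') (hh : ∀ x i, |h x i| ≤ 1) {t : ℝ} (ht : 0 < t) :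
    ∑ x, ∑ i, bitSign (x i) * h x i ≤ 2 ^ n * (Real.log K / t + t * n / 2) := by
  have hKpos : 0 < (K : ℝ) := by
    have : 0 < (Finset.univ.image s).card := Finset.card_pos.2 (Finset.univ_nonempty.image s)
    exact_mod_cast this.trans_le hK
  -- `exp a` bounds the mean exponential moment: `K` messages, each contributing at most `exp (t² n
  -- / 2)`.
  set a : ℝ := Real.log K + t ^ 2 * n / 2 with ha
  have hbound : ∑ x, Real.exp (t * ∑ i, bitSign (x i) * h x i) ≤
      K * (2 ^ n * Real.exp (t ^ 2 * n / 2)) := by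
    -- On the fibre of one message `h` is a fixed vector; the terms are positive, so the fibre may
    -- be enlarged to the whole cube.
    rw [← Finset.sum_fiberwise_of_maps_to (s := Finset.univ) (t := Finset.univ.image s) (g := s)
      (fun x _ => Finset.mem_image_of_mem s (Finset.mem_univ x))]
    calc _ ≤ ∑ _m ∈ Finset.univ.image s, 2 ^ n * Real.exp (t ^ 2 * n / 2) := by
          refine Finset.sum_le_sum fun m hm => ?_
          obtain ⟨x₀, -, rfl⟩ := Finset.mem_image.1 hm
          refine le_trans ?_ (sum_exp_bitSign_le (h x₀) (hh x₀) t)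
          calc _ = ∑ x ∈ Finset.univ.filter (fun x => s x = s x₀),
                Real.exp (t * ∑ i, bitSign (x i) * h x₀ i) := by
                refine Finset.sum_congr rfl fun x hx => ?_
                rw [hs x x₀ (Finset.mem_filter.1 hx).2]
            _ ≤ _ := Finset.sum_le_sum_of_subset_of_nonneg (Finset.filter_subset _ _)
                fun _ _ _ => (Real.exp_pos _).le
      _ ≤ _ := by
          rw [Finset.sum_const, nsmul_eq_mul]
          exact mul_le_mul_of_nonneg_right (by exact_mod_cast hK) (by positivity)
  have hexp : K * (2 ^ n * Real.exp (t ^ 2 * n / 2)) = 2 ^ n * Real.exp a := by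
    rw [ha, Real.exp_add, Real.exp_log hKpos]
    ring
  -- The tangent `u - a + 1 ≤ exp (u - a)` plays the role of Jensen's inequality and turns the
  -- moment bound into a bound on the mean.
  have hlin : ∑ x : Fin n → Bool, (t * ∑ i, bitSign (x i) * h x i - a + 1) ≤ 2 ^ n := by
    calc _ ≤ ∑ x : Fin n → Bool, Real.exp (t * ∑ i, bitSign (x i) * h x i) * Real.exp (-a) := by
          refine Finset.sum_le_sum fun x _ => ?_
          rw [← Real.exp_add, ← sub_eq_add_neg]
          exact Real.add_one_le_exp _
      _ ≤ 2 ^ n * Real.exp a * Real.exp (-a) := by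
          rw [← Finset.sum_mul]
          exact mul_le_mul_of_nonneg_right (hbound.trans hexp.le) (Real.exp_pos _).le
      _ = 2 ^ n := by
          rw [mul_assoc, ← Real.exp_add, add_neg_cancel, Real.exp_zero, mul_one]
  have hcard : ((Finset.univ : Finset (Fin n → Bool)).card : ℝ) = 2 ^ n := by
    simp [Finset.card_univ]
  rw [Finset.sum_add_distrib, Finset.sum_sub_distrib, ← Finset.mul_sum, Finset.sum_const,
    Finset.sum_const, nsmul_eq_mul, nsmul_eq_mul, hcard] at hlin
  have h6 : t * ∑ x, ∑ i, bitSign (x i) * h x i ≤ 2 ^ n * a := by linarith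
  have h7 : (2 : ℝ) ^ n * (Real.log K / t + t * n / 2) = (2 ^ n * a) / t := by
    rw [ha]; field_simp
  rw [h7, le_div_iff₀ ht, mul_comm]
  exact h6

/-- There are at most `4 ^ B` bit strings of length at most `B`. -/
theorem card_le_of_length_le {B : ℕ} (T : Finset (List Bool)) (hT : ∀ l ∈ T, l.length ≤ B) :
    T.card ≤ 4 ^ B := by
  -- A string is recovered from its length and its padding to `B` bits.
  have hinj : Set.InjOn (fun l : List Bool =>
      ((⟨min l.length B, by omega⟩ : Fin (B + 1)), fun i : Fin B => l.getD i false)) T := by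
    intro l hl l' hl' he
    simp only [Prod.mk.injEq, Fin.mk.injEq] at he
    obtain ⟨h1, h2⟩ := he
    have hlen := hT l hl
    have hlen' := hT l' hl'
    have h3 : l.length = l'.length := by omega
    refine List.ext_getElem h3 fun i hi hi' => ?_
    have := congrFun h2 ⟨i, by omega⟩
    simpa [hi, hi'] using this
  have h1 := Finset.card_le_card_of_injOn _ (t := Finset.univ) (fun _ _ => Finset.mem_univ _) hinj
  refine h1.trans ?_
  rw [Finset.card_univ, Fintype.card_prod, Fintype.card_fin, Fintype.card_fun, Fintype.card_bool,
    Fintype.card_fin]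
  calc (B + 1) * 2 ^ B ≤ 2 ^ B * 2 ^ B := Nat.mul_le_mul_right _ Nat.lt_two_pow_self
    _ = 4 ^ B := by rw [← mul_pow]; norm_num

/-- Resampling one coordinate does not change a sum over all functions. -/
theorem sum_sum_update {ι α : Type*} [Fintype ι] [DecidableEq ι] [Fintype α]
    (F : (ι → α) → ℝ) (j : ι) :
    ∑ f : ι → α, ∑ a, F (Function.update f j a) = Fintype.card α * ∑ f, F f := by
  -- Exchanging the `j`-th value with the fresh one is an involution, so the resampled function is
  -- again uniform.
  let e : (ι → α) × α → (ι → α) × α := fun p => (Function.update p.1 j p.2, p.1 j)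
  have he : Function.Involutive e := fun p => by simp [e]
  calc ∑ f : ι → α, ∑ a, F (Function.update f j a) = ∑ p : (ι → α) × α, F (e p).1 := by
        rw [Fintype.sum_prod_type]
    _ = ∑ p : (ι → α) × α, F p.1 := Equiv.sum_comp he.toPerm fun p => F p.1
    _ = _ := by
        rw [Fintype.sum_prod_type, Finset.mul_sum]
        simp

/-! ### Locality of two-round algorithms -/

theorem mem_neighbors {I : LabeledGraph} {v w : Fin I.order} :
    w ∈ neighbors I v ↔ I.graph.Adj v w := by
  simp [neighbors]

theorem history_succ (A : Algorithm) (I : LabeledGraph) (id : Fin I.order → ℕ) (t : ℕ)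
    (v : Fin I.order) :
    history A I id (t + 1) v =
      ((neighbors I v).image fun w => (id w, message A I id t w v)) :: history A I id t v := rfl

/-- After two rounds, a node does not distinguish two labellings that agree on its closed
neighborhood and for which the nodes of that neighborhood receive the same messages in the first
round. -/
theorem nodeAccepts_two_congr (A : Algorithm) {N : ℕ} (hN : 0 < N) (G : SimpleGraph (Fin N))
    (ℓ ℓ' : Fin N → List Bool) (id : Fin N → ℕ) (v : Fin N)
    (hlab : ∀ w, w = v ∨ G.Adj v w → ℓ w = ℓ' w)
    (hmsg : ∀ w, w = v ∨ G.Adj v w → ∀ y, G.Adj w y →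
      message A ⟨N, hN, G, ℓ⟩ id 0 y w = message A ⟨N, hN, G, ℓ'⟩ id 0 y w) :
    NodeAccepts A ⟨N, hN, G, ℓ⟩ id 2 v ↔ NodeAccepts A ⟨N, hN, G, ℓ'⟩ id 2 v := by
  have hin : ∀ w, w = v ∨ G.Adj v w →
      localInput ⟨N, hN, G, ℓ⟩ id w = localInput ⟨N, hN, G, ℓ'⟩ id w := by
    intro w hw
    simp only [localInput, LocalInput.mk.injEq, true_and]
    exact ⟨rfl, hlab w hw⟩
  have hh : ∀ w, w = v ∨ G.Adj v w →
      history A ⟨N, hN, G, ℓ⟩ id 1 w = history A ⟨N, hN, G, ℓ'⟩ id 1 w := by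
    intro w hw
    rw [history_succ, history_succ]
    congr 1
    refine Finset.image_congr fun y hy => ?_
    simp only [hmsg w hw y (mem_neighbors.1 (Finset.mem_coe.1 hy))]
  have hh2 : history A ⟨N, hN, G, ℓ⟩ id 2 v = history A ⟨N, hN, G, ℓ'⟩ id 2 v := by
    rw [history_succ, history_succ A ⟨N, hN, G, ℓ'⟩, hh v (Or.inl rfl)]
    congr 1
    refine Finset.image_congr fun y hy => ?_
    simp only [message]
    have hy' := Or.inr (a := y = v) (mem_neighbors.1 (Finset.mem_coe.1 hy))
    simp only [hin y hy', hh y hy']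
  unfold NodeAccepts
  rw [hh2, hin v (Or.inl rfl)]

theorem message_zero_congr (A : Algorithm) {N : ℕ} (hN : 0 < N) (G : SimpleGraph (Fin N))
    (ℓ ℓ' : Fin N → List Bool) (id : Fin N → ℕ) (v w : Fin N) (h : ℓ v = ℓ' v) :
    message A ⟨N, hN, G, ℓ⟩ id 0 v w = message A ⟨N, hN, G, ℓ'⟩ id 0 v w := by
  have : localInput ⟨N, hN, G, ℓ⟩ id v = localInput ⟨N, hN, G, ℓ'⟩ id v := by
    simp only [localInput, LocalInput.mk.injEq, true_and]
    exact ⟨rfl, h⟩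
  simp only [message, history, this]

/-- The labelled graph on `Fin N` that is obtained by numbering the vertices of `G`. -/
def LabeledGraph.ofEquiv {V : Type*} {N : ℕ} (hN : 0 < N) (e : V ≃ Fin N) (G : SimpleGraph V)
    (ℓ : V → List Bool) : LabeledGraph :=
  ⟨N, hN, G.comap e.symm, fun v => ℓ (e.symm v)⟩

section ofEquiv

variable {V : Type*} {N : ℕ} (hN : 0 < N) (e : V ≃ Fin N) (G : SimpleGraph V)
  (ℓ ℓ' : V → List Bool)

theorem LabeledGraph.ofEquiv_adj (v w : V) :
    (LabeledGraph.ofEquiv hN e G ℓ).graph.Adj (e v) (e w) ↔ G.Adj v w := by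
  simp [LabeledGraph.ofEquiv]

theorem nodeAccepts_ofEquiv_congr (A : Algorithm) (id : Fin N → ℕ) (v : V)
    (hlab : ∀ w, w = v ∨ G.Adj v w → ℓ w = ℓ' w)
    (hmsg : ∀ w, w = v ∨ G.Adj v w → ∀ y, G.Adj w y →
      message A (LabeledGraph.ofEquiv hN e G ℓ) id 0 (e y) (e w) =
        message A (LabeledGraph.ofEquiv hN e G ℓ') id 0 (e y) (e w)) :
    NodeAccepts A (LabeledGraph.ofEquiv hN e G ℓ) id 2 (e v) ↔
      NodeAccepts A (LabeledGraph.ofEquiv hN e G ℓ') id 2 (e v) := by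
  have hnear : ∀ w, w = e v ∨ (G.comap e.symm).Adj (e v) w →
      e.symm w = v ∨ G.Adj v (e.symm w) := by
    rintro w (rfl | hw)
    · simp
    · right; simpa using hw
  refine nodeAccepts_two_congr A hN (G.comap e.symm) _ _ id (e v)
    (fun w hw => hlab _ (hnear w hw)) fun w hw y hy => ?_
  have := hmsg (e.symm w) (hnear w hw) (e.symm y) (by simpa using hy)
  simpa [LabeledGraph.ofEquiv] using this

theorem message_ofEquiv_congr (A : Algorithm) (id : Fin N → ℕ) (v w : V) (h : ℓ v = ℓ' v) :
    message A (LabeledGraph.ofEquiv hN e G ℓ) id 0 (e v) (e w) =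
      message A (LabeledGraph.ofEquiv hN e G ℓ') id 0 (e v) (e w) :=
  message_zero_congr A hN _ _ _ id _ _ (by simpa using h)

end ofEquiv

/-! ### Families of hard instances -/

/-- A family of labellings of a graph made of `k` mutually disconnected gadgets. In the `j`-th
gadget, the string `(θ j).1` is known only to the node `src j`, whose only neighbor is `relay j`,
and the bit `b j` is known only to the node `tgt j`, which is at distance at least `3` from
`src j` and its neighbor. -/
structure HardFamily (V : Type) (k n : ℕ) where
  graph : SimpleGraph V
  label : (Fin k → (Fin n → Bool) × Fin n) → (Fin k → Bool) → V → List Bool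
  comp : V → Fin k
  comp_eq_of_adj : ∀ v w, graph.Adj v w → comp v = comp w
  src : Fin k → V
  relay : Fin k → V
  tgt : Fin k → V
  comp_src : ∀ j, comp (src j) = j
  comp_tgt : ∀ j, comp (tgt j) = j
  eq_relay_of_adj : ∀ j w, graph.Adj (src j) w → w = relay j
  label_src : ∀ θ θ' b j, (θ j).1 = (θ' j).1 → label θ b (src j) = label θ' b (src j)
  label_of_ne_src : ∀ θ b j x x' i v, v ≠ src j →
    label (Function.update θ j (x, i)) b v = label (Function.update θ j (x', i)) b v
  label_of_ne_tgt : ∀ θ b j c v, v ≠ tgt j → label θ (Function.update b j c) v = label θ b v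
  far : ∀ j v w w', v = src j ∨ graph.Adj (src j) v → w = v ∨ graph.Adj v w →
    w' = w ∨ graph.Adj w w' → w' ≠ tgt j

namespace HardFamily

variable {V : Type} {k n N : ℕ} (F : HardFamily V k n) (hN : 0 < N) (e : V ≃ Fin N)
  (A : Algorithm) (id : Fin N → ℕ)

/-- The numbered instances of the family. -/
abbrev inst (θ : Fin k → (Fin n → Bool) × Fin n) (b : Fin k → Bool) : LabeledGraph :=
  LabeledGraph.ofEquiv hN e F.graph (F.label θ b)

/-- The bits `b` of the correct instances. -/
def correct (θ : Fin k → (Fin n → Bool) × Fin n) (j : Fin k) : Bool := !((θ j).1 (θ j).2)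

/-- The correct bits, except that the `j`-th bit is wrong. -/
def wrong (θ : Fin k → (Fin n → Bool) × Fin n) (j : Fin k) : Fin k → Bool :=
  Function.update (correct θ) j ((θ j).1 (θ j).2)

/-- Node `v` accepts after two rounds. -/
def Acc (θ : Fin k → (Fin n → Bool) × Fin n) (b : Fin k → Bool) (v : V) : Prop :=
  NodeAccepts A (F.inst hN e θ b) id 2 (e v)

open Classical in
/-- The indicator of the event that all nodes accept. -/
noncomputable def accAll (θ : Fin k → (Fin n → Bool) × Fin n) (b : Fin k → Bool) : ℝ :=
  if ∀ v, F.Acc hN e A id θ b v then 1 else 0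

open Classical in
/-- The indicator of the event that all nodes accept, save perhaps those near `src j`. -/
noncomputable def accFar (j : Fin k) (θ : Fin k → (Fin n → Bool) × Fin n) (b : Fin k → Bool) : ℝ :=
  if ∀ v, v ≠ F.src j → ¬ F.graph.Adj (F.src j) v → F.Acc hN e A id θ b v then 1 else 0

/-- Two rounds carry information over distance at most two, and `tgt j` lies beyond. -/
theorem acc_update_of_forall_ne_tgt {j : Fin k} {v : V}
    (hv : ∀ w w', w = v ∨ F.graph.Adj v w → w' = w ∨ F.graph.Adj w w' → w' ≠ F.tgt j)
    (θ : Fin k → (Fin n → Bool) × Fin n) (b : Fin k → Bool) (c : Bool) :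
    F.Acc hN e A id θ (Function.update b j c) v ↔ F.Acc hN e A id θ b v := by
  refine nodeAccepts_ofEquiv_congr hN e F.graph _ _ A id v (fun w hw => ?_) fun w hw y hy => ?_
  · exact F.label_of_ne_tgt _ _ _ _ _ (hv w w hw (Or.inl rfl))
  · exact message_ofEquiv_congr hN e F.graph _ _ A id _ _
      (F.label_of_ne_tgt _ _ _ _ _ (hv w y hw (Or.inr hy)))

theorem acc_update_of_comp_ne {j : Fin k} {v : V} (hv : F.comp v ≠ j)
    (θ : Fin k → (Fin n → Bool) × Fin n) (b : Fin k → Bool) (c : Bool) :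
    F.Acc hN e A id θ (Function.update b j c) v ↔ F.Acc hN e A id θ b v := by
  refine F.acc_update_of_forall_ne_tgt hN e A id (fun w w' hw hw' h => hv ?_) θ b c
  have h1 : F.comp w = F.comp v := by
    rcases hw with rfl | hw
    · rfl
    · exact (F.comp_eq_of_adj _ _ hw).symm
  have h2 : F.comp w' = F.comp w := by
    rcases hw' with rfl | hw
    · rfl
    · exact (F.comp_eq_of_adj _ _ hw).symm
  rw [← h1, ← h2, h, F.comp_tgt]

theorem acc_update_of_near_src {j : Fin k} {v : V} (hv : v = F.src j ∨ F.graph.Adj (F.src j) v)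
    (θ : Fin k → (Fin n → Bool) × Fin n) (b : Fin k → Bool) (c : Bool) :
    F.Acc hN e A id θ (Function.update b j c) v ↔ F.Acc hN e A id θ b v :=
  F.acc_update_of_forall_ne_tgt hN e A id (fun w w' => F.far j v w w' hv) θ b c

/-- Far from `src j`, nodes depend on the string at `src j` only through its first message. -/
theorem acc_update_of_message_eq {j : Fin k} {v : V} (hv : v ≠ F.src j)
    (hv' : ¬ F.graph.Adj (F.src j) v) (θ : Fin k → (Fin n → Bool) × Fin n) (b : Fin k → Bool)
    (x x' : Fin n → Bool) (i : Fin n)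
    (hm : message A (F.inst hN e (Function.update θ j (x, i)) b) id 0 (e (F.src j))
        (e (F.relay j)) =
      message A (F.inst hN e (Function.update θ j (x', i)) b) id 0 (e (F.src j))
        (e (F.relay j))) :
    F.Acc hN e A id (Function.update θ j (x, i)) b v ↔
      F.Acc hN e A id (Function.update θ j (x', i)) b v := by
  refine nodeAccepts_ofEquiv_congr hN e F.graph _ _ A id v (fun w hw => ?_) fun w hw y hy => ?_
  · refine F.label_of_ne_src _ _ _ _ _ _ _ ?_
    rintro rfl
    rcases hw with rfl | hw
    · exact hv rfl
    · exact hv' hw.symm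
  -- The first message of `src j` to its only neighbour is the one channel through which `x` reaches
  -- `v`.
  · by_cases hy' : y = F.src j
    · subst hy'
      obtain rfl := F.eq_relay_of_adj j w hy.symm
      exact hm
    · exact message_ofEquiv_congr hN e F.graph _ _ A id _ _
        (F.label_of_ne_src _ _ _ _ _ _ _ hy')

/-! ### Acceptance indicators, averaged over strings and indices -/

theorem accFar_nonneg (j : Fin k) (θ : Fin k → (Fin n → Bool) × Fin n) (b : Fin k → Bool) :
    0 ≤ F.accFar hN e A id j θ b := by
  unfold accFar; split_ifs <;> norm_num

theorem accFar_le_one (j : Fin k) (θ : Fin k → (Fin n → Bool) × Fin n) (b : Fin k → Bool) :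
    F.accFar hN e A id j θ b ≤ 1 := by
  unfold accFar; split_ifs <;> norm_num

theorem accAll_nonneg (θ : Fin k → (Fin n → Bool) × Fin n) (b : Fin k → Bool) :
    0 ≤ F.accAll hN e A id θ b := by
  unfold accAll; split_ifs <;> norm_num

/-- If all nodes accept the correct instance, then flipping a bit is detected only far from the
source. Otherwise, some node rejects, and flipping a bit matters only in the gadget of that
node. -/
theorem sum_accAll_sub_le (θ : Fin k → (Fin n → Bool) × Fin n) :
    ∑ j, (F.accAll hN e A id θ (correct θ) - F.accAll hN e A id θ (wrong θ j)) ≤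
      1 - F.accAll hN e A id θ (correct θ) +
        ∑ j, (F.accFar hN e A id j θ (correct θ) - F.accFar hN e A id j θ (wrong θ j)) := by
  by_cases hall : ∀ v, F.Acc hN e A id θ (correct θ) v
  · have h1 : F.accAll hN e A id θ (correct θ) = 1 := if_pos hall
    rw [h1, sub_self, zero_add]
    refine Finset.sum_le_sum fun j _ => ?_
    have h2 : F.accFar hN e A id j θ (correct θ) = 1 := if_pos fun v _ _ => hall v
    -- The nodes near `src j` do not see the flip and still accept, so acceptance far from `src j`
    -- already means acceptance everywhere.
    have h3 : F.accFar hN e A id j θ (wrong θ j) ≤ F.accAll hN e A id θ (wrong θ j) := by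
      by_cases hfar : ∀ v, v ≠ F.src j → ¬ F.graph.Adj (F.src j) v →
          F.Acc hN e A id θ (wrong θ j) v
      · have h4 : ∀ v, F.Acc hN e A id θ (wrong θ j) v := by
          intro v
          by_cases hv : v = F.src j ∨ F.graph.Adj (F.src j) v
          · exact (F.acc_update_of_near_src hN e A id hv θ _ _).2 (hall v)
          · exact hfar v (fun h => hv (Or.inl h)) fun h => hv (Or.inr h)
        have h5 : F.accAll hN e A id θ (wrong θ j) = 1 := if_pos h4
        rw [h5]
        exact F.accFar_le_one hN e A id j θ _
      · have h5 : F.accFar hN e A id j θ (wrong θ j) = 0 := if_neg hfar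
        rw [h5]
        exact F.accAll_nonneg hN e A id θ _
    linarith
  · have h1 : F.accAll hN e A id θ (correct θ) = 0 := if_neg hall
    push Not at hall
    obtain ⟨v₀, hv₀⟩ := hall
    -- Only the gadget of the rejecting node `v₀` can cost `1`: for any other `j`, `v₀` is far from
    -- `src j`, does not see the `j`-th bit, and keeps rejecting.
    have h2 : ∀ j, F.accFar hN e A id j θ (wrong θ j) - F.accFar hN e A id j θ (correct θ) -
        F.accAll hN e A id θ (wrong θ j) ≤ if F.comp v₀ = j then 1 else 0 := by
      intro j
      have ha := F.accFar_nonneg hN e A id j θ (correct θ)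
      have hb := F.accAll_nonneg hN e A id θ (wrong θ j)
      split_ifs with hj
      · linarith [F.accFar_le_one hN e A id j θ (wrong θ j)]
      · have h3 : F.accFar hN e A id j θ (wrong θ j) = 0 := by
          refine if_neg fun hfar => hv₀ ?_
          refine (F.acc_update_of_comp_ne hN e A id hj θ _ _).1 (hfar v₀ ?_ ?_)
          · rintro rfl
            exact hj (F.comp_src j)
          · intro h
            exact hj ((F.comp_eq_of_adj _ _ h).symm.trans (F.comp_src j))
        linarith
    have h3 := Finset.sum_le_sum fun j (_ : j ∈ Finset.univ) => h2 j
    rw [Finset.sum_ite_eq, if_pos (Finset.mem_univ _)] at h3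
    simp only [Finset.sum_sub_distrib] at h3 ⊢
    simp only [h1, Finset.sum_const_zero] at h3 ⊢
    linarith

/-- With all other gadgets fixed, the far verdict for a given index and bit is a function of one
message with at most `4 ^ B` values. Its change under the bit is therefore nearly uncorrelated with
`x i`. -/
theorem sum_accFar_fiber_le {B : ℕ} (j : Fin k)
    (hB : ∀ θ b, (message A (F.inst hN e θ b) id 0 (e (F.src j)) (e (F.relay j))).length ≤ B)
    {t : ℝ} (ht : 0 < t) (θ : Fin k → (Fin n → Bool) × Fin n) :
    ∑ p, (F.accFar hN e A id j (Function.update θ j p) (correct (Function.update θ j p)) -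
        F.accFar hN e A id j (Function.update θ j p) (wrong (Function.update θ j p) j)) ≤
      2 ^ n * (2 * B / t + t * n / 2) := by
  let q : (Fin n → Bool) → Fin n → Bool → ℝ := fun x i c =>
    F.accFar hN e A id j (Function.update θ j (x, i)) (Function.update (correct θ) j c)
  have hc : ∀ x i, correct (Function.update θ j (x, i)) =
      Function.update (correct θ) j (!(x i)) := by
    intro x i
    funext j'
    by_cases h : j' = j
    · subst h; simp [correct]
    · simp [correct, h]
  have hw : ∀ x i, wrong (Function.update θ j (x, i)) j =
      Function.update (correct θ) j (x i) := by
    intro x i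
    rw [wrong, hc]
    simp
  -- The index `(θ j).2` and the bits `correct θ` are placeholders: the first message of `src j`
  -- depends on neither.
  let s : (Fin n → Bool) → List Bool := fun x =>
    message A (F.inst hN e (Function.update θ j (x, (θ j).2)) (correct θ)) id 0 (e (F.src j))
      (e (F.relay j))
  have hne : F.src j ≠ F.tgt j := F.far j _ _ _ (Or.inl rfl) (Or.inl rfl) (Or.inl rfl)
  have hmsg : ∀ x i c, message A (F.inst hN e (Function.update θ j (x, i))
      (Function.update (correct θ) j c)) id 0 (e (F.src j)) (e (F.relay j)) = s x := by
    intro x i c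
    have h1 : F.label (Function.update θ j (x, i)) (Function.update (correct θ) j c) (F.src j) =
        F.label (Function.update θ j (x, (θ j).2)) (correct θ) (F.src j) := by
      rw [F.label_of_ne_tgt _ _ _ _ _ hne]
      exact F.label_src _ _ _ _ (by simp)
    exact message_ofEquiv_congr hN e F.graph _ _ A id _ _ h1
  have hcard : (Finset.univ.image s).card ≤ 4 ^ B := by
    refine card_le_of_length_le _ fun l hl => ?_
    obtain ⟨x, -, rfl⟩ := Finset.mem_image.1 hl
    rw [← hmsg x (θ j).2 true]
    exact hB _ _
  have hq : ∀ x x', s x = s x' → ∀ i c, q x i c = q x' i c := by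
    intro x x' hs i c
    have : ∀ v, v ≠ F.src j → ¬ F.graph.Adj (F.src j) v →
        (F.Acc hN e A id (Function.update θ j (x, i)) (Function.update (correct θ) j c) v ↔
        F.Acc hN e A id (Function.update θ j (x', i)) (Function.update (correct θ) j c) v) := by
      intro v hv hv'
      refine F.acc_update_of_message_eq hN e A id hv hv' θ _ x x' i ?_
      rw [hmsg, hmsg, hs]
    have h2 : (∀ v, v ≠ F.src j → ¬ F.graph.Adj (F.src j) v →
        F.Acc hN e A id (Function.update θ j (x, i)) (Function.update (correct θ) j c) v) ↔
        ∀ v, v ≠ F.src j → ¬ F.graph.Adj (F.src j) v →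
        F.Acc hN e A id (Function.update θ j (x', i)) (Function.update (correct θ) j c) v :=
      forall_congr' fun v => forall_congr' fun hv => forall_congr' fun hv' => this v hv hv'
    simp only [q, accFar]
    split_ifs with ha hb hb
    · rfl
    · exact absurd (h2.1 ha) hb
    · exact absurd (h2.2 hb) ha
    · rfl
  have hlog : Real.log ((4 ^ B : ℕ) : ℝ) ≤ 2 * B := by
    push_cast
    rw [Real.log_pow, show (4 : ℝ) = 2 ^ 2 by norm_num, Real.log_pow]
    have := Real.log_two_lt_d9
    push_cast
    nlinarith [Nat.cast_nonneg (α := ℝ) B]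
  have key := sum_bitSign_mul_le s hcard (fun x i => q x i false - q x i true)
    (fun x x' hs => by funext i; rw [hq x x' hs, hq x x' hs])
    (fun x i => by
      have h1 := F.accFar_nonneg hN e A id j (Function.update θ j (x, i))
      have h2 := F.accFar_le_one hN e A id j (Function.update θ j (x, i))
      rw [abs_le]
      constructor
      · linarith [h1 (Function.update (correct θ) j false),
          h2 (Function.update (correct θ) j true)]
      · linarith [h1 (Function.update (correct θ) j true),
          h2 (Function.update (correct θ) j false)]) ht
  -- The correct bit is the negation of `x i`, so correct minus wrong is `q false - q true` when `x
  -- i` is true and its opposite otherwise.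
  calc _ = ∑ x, ∑ i, bitSign (x i) * (q x i false - q x i true) := by
        rw [Fintype.sum_prod_type]
        refine Finset.sum_congr rfl fun x _ => Finset.sum_congr rfl fun i _ => ?_
        rw [hc, hw]
        cases x i <;> simp [bitSign, q]
    _ ≤ _ := key
    _ ≤ _ := by gcongr

/-- Resampling the data of gadget `j` preserves the uniform average, which reduces the claim to the
fibre bound. -/
theorem sum_accFar_le {B : ℕ} (j : Fin k)
    (hB : ∀ θ b, (message A (F.inst hN e θ b) id 0 (e (F.src j)) (e (F.relay j))).length ≤ B)
    (hn : 0 < n) {t : ℝ} (ht : 0 < t) :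
    ∑ θ, (F.accFar hN e A id j θ (correct θ) - F.accFar hN e A id j θ (wrong θ j)) ≤
      Fintype.card (Fin k → (Fin n → Bool) × Fin n) * (2 * B / (t * n) + t / 2) := by
  have h1 := sum_sum_update (fun θ => F.accFar hN e A id j θ (correct θ) -
    F.accFar hN e A id j θ (wrong θ j)) j
  have h2 := Finset.sum_le_sum fun θ (_ : θ ∈ Finset.univ) =>
    F.sum_accFar_fiber_le hN e A id j hB ht θ
  rw [h1, Finset.sum_const, nsmul_eq_mul, Finset.card_univ] at h2
  have hn' : (0 : ℝ) < n := by exact_mod_cast hn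
  have hcard : (Fintype.card ((Fin n → Bool) × Fin n) : ℝ) = 2 ^ n * n := by
    simp [Fintype.card_prod]
  rw [hcard] at h2
  have h3 : (2 : ℝ) ^ n * (2 * B / t + t * n / 2) =
      2 ^ n * n * (2 * B / (t * n) + t / 2) := by
    field_simp
  rw [h3] at h2
  have hpos : (0 : ℝ) < 2 ^ n * n := by positivity
  refine le_of_mul_le_mul_left (h2.trans_eq ?_) hpos
  ring

/-- For a fixed algorithm, the acceptance rates of correct and wrong instances are close. -/
theorem sum_accAll_le {B : ℕ}
    (hB : ∀ j θ b, (message A (F.inst hN e θ b) id 0 (e (F.src j)) (e (F.relay j))).length ≤ B)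
    (hn : 0 < n) {t : ℝ} (ht : 0 < t) :
    ∑ θ, ((k + 1) * F.accAll hN e A id θ (correct θ) -
        ∑ j, F.accAll hN e A id θ (wrong θ j)) ≤
      Fintype.card (Fin k → (Fin n → Bool) × Fin n) *
        (1 + k * (2 * B / (t * n) + t / 2)) := by
  have h1 := Finset.sum_le_sum fun θ (_ : θ ∈ Finset.univ) => F.sum_accAll_sub_le hN e A id θ
  have h2 := Finset.sum_le_sum fun j (_ : j ∈ Finset.univ) =>
    F.sum_accFar_le hN e A id j (hB j) hn ht
  rw [Finset.sum_comm] at h2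
  simp only [Finset.sum_sub_distrib, Finset.sum_add_distrib, Finset.sum_const, Finset.card_univ,
    nsmul_eq_mul, Fintype.card_fin, ← Finset.mul_sum, mul_one] at h1 h2 ⊢
  linarith

end HardFamily

/-! ### Randomized algorithms, by integration over the coins -/

open MeasureTheory in
/-- A lower bound on the error of randomized algorithms that perform a `CONGEST` round and then a
`LOCAL` round, and that separate the correct instances of a hard family from the wrong ones. -/
theorem HardFamily.error_bound {V : Type} {k n N : ℕ} (F : HardFamily V k n) (hN : 0 < N)
    (e : V ≃ Fin N) {M : ℕ → ℕ} (hM : N ≤ M N) {L : DistLanguage} {δ : ℝ}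
    {Ω : Type} [MeasurableSpace Ω] (μ : Measure Ω) [IsProbabilityMeasure μ] (A : Ω → Algorithm)
    (hmeas : IsMeasurableAlgorithm M [RoundKind.CONGEST, RoundKind.LOCAL] A) {c : ℕ}
    (hband : ∀ ω, RespectsBandwidth M [RoundKind.CONGEST, RoundKind.LOCAL] c (A ω))
    (hdec : ∀ (I : LabeledGraph) (id : Fin I.order → ℕ), IsIdAssignment M I id →
      (I ∈ L → 1 - δ ≤ μ.real {ω | AllAccept (A ω) I id 2}) ∧
      (I ∉ L → 1 - δ ≤ μ.real {ω | ∃ v, ¬ NodeAccepts (A ω) I id 2 v}))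
    (hrelay : ∀ j, F.graph.Adj (F.src j) (F.relay j))
    (hyes : ∀ θ, F.inst hN e θ (correct θ) ∈ L)
    (hno : ∀ θ j, F.inst hN e θ (wrong θ j) ∉ L)
    (hn : 0 < n) {t : ℝ} (ht : 0 < t) :
    k * (1 - 2 * δ) ≤ δ + k * (2 * (c * Nat.log 2 N : ℕ) / (t * n) + t / 2) := by
  classical
  -- One fixed assignment suffices for a lower bound; `1, …, N` is admissible because `N ≤ M N`.
  let id : Fin N → ℕ := fun v => v + 1
  have hid : ∀ θ b, IsIdAssignment M (F.inst hN e θ b) id := by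
    refine fun θ b => ⟨fun v w h => Fin.ext (by simpa [id] using h), fun v => ⟨by simp [id], ?_⟩⟩
    exact (Nat.succ_le_of_lt v.2).trans hM
  have hall : ∀ ω θ b, (∀ v, F.Acc hN e (A ω) id θ b v) ↔
      AllAccept (A ω) (F.inst hN e θ b) id 2 :=
    fun ω θ b => ⟨fun h v => by
      obtain ⟨w, rfl⟩ := e.surjective v
      exact h w, fun h v => h (e v)⟩
  have hmeasAll : ∀ θ b, MeasurableSet {ω | AllAccept (A ω) (F.inst hN e θ b) id 2} := by
    intro θ b
    have := MeasurableSet.iInter fun v => (hmeas (F.inst hN e θ b) id (hid θ b)).2 v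
    convert this using 1
    ext ω
    simp [AllAccept]
  have hint : ∀ θ b, (fun ω => F.accAll hN e (A ω) id θ b) =
      Set.indicator {ω | AllAccept (A ω) (F.inst hN e θ b) id 2} 1 := by
    intro θ b
    funext ω
    simp only [accAll, Set.indicator, Set.mem_ofPred_eq, hall, Pi.one_apply]
  have hintegrable : ∀ θ b, Integrable (fun ω => F.accAll hN e (A ω) id θ b) μ := by
    intro θ b
    rw [hint]
    exact (integrable_const (1 : ℝ)).indicator (hmeasAll θ b)
  have hintegral : ∀ θ b, ∫ ω, F.accAll hN e (A ω) id θ b ∂μ =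
      μ.real {ω | AllAccept (A ω) (F.inst hN e θ b) id 2} := by
    intro θ b
    rw [hint, integral_indicator_one (hmeasAll θ b)]
  have hyes' : ∀ θ, 1 - δ ≤ ∫ ω, F.accAll hN e (A ω) id θ (correct θ) ∂μ := by
    intro θ
    rw [hintegral]
    exact (hdec (F.inst hN e θ (correct θ)) id (hid θ _)).1 (hyes θ)
  have hno' : ∀ θ j, ∫ ω, F.accAll hN e (A ω) id θ (wrong θ j) ∂μ ≤ δ := by
    intro θ j
    rw [hintegral]
    have h1 := (hdec (F.inst hN e θ (wrong θ j)) id (hid θ (wrong θ j))).2 (hno θ j)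
    have h2 : {ω | ∃ v, ¬ NodeAccepts (A ω) (F.inst hN e θ (wrong θ j)) id 2 v} =
        {ω | AllAccept (A ω) (F.inst hN e θ (wrong θ j)) id 2}ᶜ := by
      ext ω
      simp [AllAccept]
    rw [h2, measureReal_compl (hmeasAll _ _), probReal_univ] at h1
    linarith
  -- For fixed coins the algorithm is deterministic, and `B = c log₂ N` bounds the first message.
  have hpoint : ∀ ω, ∑ θ, ((k + 1) * F.accAll hN e (A ω) id θ (correct θ) -
        ∑ j, F.accAll hN e (A ω) id θ (wrong θ j)) ≤
      Fintype.card (Fin k → (Fin n → Bool) × Fin n) *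
        (1 + k * (2 * (c * Nat.log 2 N : ℕ) / (t * n) + t / 2)) := by
    intro ω
    refine F.sum_accAll_le hN e (A ω) id (fun j θ b => ?_) hn ht
    refine hband ω (F.inst hN e θ b) id (hid θ b) 0 rfl _ _ ?_
    exact (LabeledGraph.ofEquiv_adj hN e F.graph _ _ _).2 (hrelay j)
  have hmono := integral_mono (μ := μ)
    (integrable_finsetSum _ fun θ _ => ((hintegrable θ (correct θ)).const_mul ((k : ℝ) + 1)).sub
      (integrable_finsetSum _ fun j _ => hintegrable θ (wrong θ j)))
    (integrable_const _) hpoint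
  rw [integral_const, probReal_univ, one_smul, integral_finsetSum _ fun θ _ =>
    ((hintegrable θ (correct θ)).const_mul ((k : ℝ) + 1)).sub
      (integrable_finsetSum _ fun j _ => hintegrable θ (wrong θ j))] at hmono
  -- The correct instance is accepted with probability at least `1 - δ`, and each of the `k` wrong
  -- ones with probability at most `δ`.
  have hterm : ∀ θ, (k + 1) * (1 - δ) - k * δ ≤
      ∫ ω, ((k + 1) * F.accAll hN e (A ω) id θ (correct θ) -
        ∑ j, F.accAll hN e (A ω) id θ (wrong θ j)) ∂μ := by
    intro θ
    rw [integral_sub ((hintegrable θ (correct θ)).const_mul ((k : ℝ) + 1))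
      (integrable_finsetSum _ fun j _ => hintegrable θ (wrong θ j)), integral_const_mul,
      integral_finsetSum _ fun j _ => hintegrable θ (wrong θ j)]
    have h1 := Finset.sum_le_sum fun j (_ : j ∈ Finset.univ) => hno' θ j
    rw [Finset.sum_const, Finset.card_univ, Fintype.card_fin, nsmul_eq_mul] at h1
    have h2 := mul_le_mul_of_nonneg_left (hyes' θ) (by positivity : (0 : ℝ) ≤ k + 1)
    linarith
  have hsum := (Finset.sum_le_sum fun θ (_ : θ ∈ Finset.univ) => hterm θ).trans hmono
  rw [Finset.sum_const, Finset.card_univ, nsmul_eq_mul] at hsum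
  have : Nonempty (Fin n) := ⟨⟨0, hn⟩⟩
  have hcard : (0 : ℝ) < Fintype.card (Fin k → (Fin n → Bool) × Fin n) := by
    exact_mod_cast Fintype.card_pos
  have := le_of_mul_le_mul_left hsum hcard
  linarith

/-- A deterministic algorithm is a randomized algorithm without error. -/
theorem decidable_subset_randDecidable (M : ℕ → ℕ) (rounds : List RoundKind) {δ : ℝ}
    (hδ : 0 ≤ δ) : Decidable M rounds ⊆ RandDecidable M rounds δ := by
  rintro L ⟨A, ⟨c, hc⟩, hA⟩
  refine ⟨Unit, ⊤, MeasureTheory.Measure.dirac (), inferInstance, fun _ => A,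
    fun I id hid => ⟨fun t ht v w hvw m => MeasurableSpace.measurableSet_top,
      fun v => MeasurableSpace.measurableSet_top⟩, ⟨c, fun _ => hc⟩,
    fun I id hid => ⟨fun h => ?_, fun h => ?_⟩⟩
  · have : {ω : Unit | AllAccept A I id rounds.length} = Set.univ :=
      Set.eq_univ_of_forall fun _ => (hA I id hid).1 h
    rw [this, MeasureTheory.probReal_univ]
    linarith
  · have : {ω : Unit | ∃ v, ¬ NodeAccepts A I id rounds.length v} = Set.univ := by
      refine Set.eq_univ_of_forall fun _ => ?_
      have := mt (hA I id hid).2 h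
      simpa [AllAccept] using this
    rw [this, MeasureTheory.probReal_univ]
    linarith

theorem LabeledGraph.ofEquiv_label {V : Type*} {N : ℕ} (hN : 0 < N) (e : V ≃ Fin N)
    (G : SimpleGraph V) (ℓ : V → List Bool) (v : V) :
    (LabeledGraph.ofEquiv hN e G ℓ).label (e v) = ℓ v := by
  simp [LabeledGraph.ofEquiv]

theorem LabeledGraph.exists_ofEquiv {V : Type*} {N : ℕ} {hN : 0 < N} {e : V ≃ Fin N}
    {G : SimpleGraph V} {ℓ : V → List Bool} {p : Fin N → Prop} :
    (∃ v : Fin (LabeledGraph.ofEquiv hN e G ℓ).order, p v) ↔ ∃ v, p (e v) :=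
  e.exists_congr_right.symm

/-- An edge forces two nodes, so the bandwidth with `c = 1` leaves room for one bit. -/
theorem one_le_log_order {I : LabeledGraph} {v w : Fin I.order} (h : I.graph.Adj v w) :
    1 ≤ Nat.log 2 I.order := by
  refine (Nat.le_log_iff_pow_le one_lt_two I.order_pos.ne').2 ?_
  have h1 : (v : ℕ) ≠ w := fun he => h.ne (Fin.ext he)
  have := v.2
  have := w.2
  omega

/-! ### A language for which the error cannot be bounded away from `1 / 2` -/

/-- Some neighbor of `w` has the bit `1` at the position of its label that is given by the length
of the label of `w`. -/
def ReadsOne (I : LabeledGraph) (w : Fin I.order) : Prop :=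
  ∃ u, I.graph.Adj w u ∧ (I.label u)[(I.label w).length]? = some true

/-- The labelled graphs where all the neighbors of a node with an empty label read the same bit. -/
def agreement : DistLanguage :=
  {I | ∀ v w w', I.label v = [] → I.graph.Adj v w → I.graph.Adj v w' →
    (ReadsOne I w ↔ ReadsOne I w')}

open Classical in
/-- Every node sends its label, then the bit that it reads. -/
noncomputable def agreementAlgorithm : Algorithm where
  send inp hist _ := match hist with
    | [] => inp.label
    | inbox :: _ => [decide (∃ p ∈ inbox, p.2[inp.label.length]? = some true)]
  accept inp hist := match hist with
    | [] => true
    | inbox :: _ => decide (inp.label = [] → ∀ p ∈ inbox, ∀ p' ∈ inbox, p.2 = p'.2)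

open Classical in
theorem message_agreementAlgorithm (I : LabeledGraph) (id : Fin I.order → ℕ)
    (v w : Fin I.order) : message agreementAlgorithm I id 1 v w = [decide (ReadsOne I v)] := by
  have : (∃ p ∈ (neighbors I v).image (fun w => (id w, message agreementAlgorithm I id 0 w v)),
      p.2[(localInput I id v).label.length]? = some true) ↔ ReadsOne I v := by
    simp only [Finset.exists_mem_image, mem_neighbors]
    rfl
  rw [message, history_succ]
  simp only [agreementAlgorithm, List.cons.injEq, and_true] at this ⊢
  exact decide_eq_decide.2 this

theorem agreement_mem_LC (M : ℕ → ℕ) : agreement ∈ LC M := by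
  classical
  refine ⟨agreementAlgorithm, ⟨1, fun I id _ t ht v w hvw => ?_⟩, fun I id _ => ?_⟩
  · obtain rfl : t = 1 := by
      rcases t with _ | _ | t <;> simp at ht ⊢
    rw [message_agreementAlgorithm, one_mul]
    exact one_le_log_order hvw
  · change (∀ v w w', _) ↔ ∀ v, _
    refine forall_congr' fun v => ?_
    have : NodeAccepts agreementAlgorithm I id 2 v ↔ (I.label v = [] →
        ∀ p ∈ (neighbors I v).image (fun w => (id w, message agreementAlgorithm I id 1 w v)),
        ∀ p' ∈ (neighbors I v).image (fun w => (id w, message agreementAlgorithm I id 1 w v)),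
          p.2 = p'.2) := by
      rw [NodeAccepts, history_succ]
      exact decide_eq_true_iff
    refine Iff.trans ?_ this.symm
    simp only [Finset.forall_mem_image, mem_neighbors, message_agreementAlgorithm,
      List.cons.injEq, and_true, decide_eq_decide]
    exact ⟨fun h h1 w hw w' hw' => h w w' h1 hw hw', fun h w w' h1 hw hw' => h h1 hw hw'⟩

/-- `k` disjoint paths of `5` nodes: the first node of the `j`-th path holds a string, the second
one an index in that string, and the last one a bit. -/
def pathFamily (k n : ℕ) : HardFamily (Fin k × Fin 5) k n where
  graph :=
    { Adj := fun p q => p.1 = q.1 ∧ ((p.2 : ℕ) + 1 = q.2 ∨ (q.2 : ℕ) + 1 = p.2)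
      symm := ⟨fun p q h => ⟨h.1.symm, h.2.symm⟩⟩
      loopless := ⟨fun p h => by omega⟩ }
  label θ b p := match p with
    -- The leading `true` keeps the label nonempty, so that only the middle node has an empty label;
    -- it shifts the string by one, hence the index is written in unary with `i + 1` symbols. The
    -- string is stored negated because the correct bit is the negation of `x i`.
    | (j, 0) => true :: List.ofFn fun i => !(θ j).1 i
    | (j, 1) => List.replicate ((θ j).2 + 1) true
    | (_, 2) => []
    | (_, 3) => [false]
    | (j, 4) => [true, b j]
  comp p := p.1
  comp_eq_of_adj _ _ h := h.1
  src j := (j, 0)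
  relay j := (j, 1)
  tgt j := (j, 4)
  comp_src _ := rfl
  comp_tgt _ := rfl
  eq_relay_of_adj j w h := by
    obtain ⟨h1, h2⟩ := h
    refine Prod.ext h1.symm (Fin.ext ?_)
    simp at h2 ⊢
    omega
  label_src θ θ' b j h := by simp [h]
  label_of_ne_src θ b j x x' i v hv := by
    obtain ⟨j', r⟩ := v
    by_cases hj : j' = j
    · subst hj
      fin_cases r <;> simp at hv ⊢
    · fin_cases r <;> simp [hj]
  label_of_ne_tgt θ b j c v hv := by
    obtain ⟨j', r⟩ := v
    by_cases hj : j' = j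
    · subst hj
      fin_cases r <;> simp at hv ⊢
    · fin_cases r <;> simp [hj]
  far j v w w' hv hw hw' h := by
    have h1 : (v.2 : ℕ) ≤ 1 := by
      rcases hv with rfl | ⟨-, hv⟩
      · simp
      · simp at hv; omega
    have h2 : (w.2 : ℕ) ≤ v.2 + 1 := by
      rcases hw with rfl | ⟨-, hw⟩ <;> omega
    have h3 : (w'.2 : ℕ) ≤ w.2 + 1 := by
      rcases hw' with rfl | ⟨-, hw⟩ <;> omega
    have h4 : (w'.2 : ℕ) = 4 := by rw [h]; rfl
    omega

/-- Only the middle nodes compare anything: one neighbour reads the negation of `x i` from the first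
node, the other reads `b j` from the last one. -/
theorem pathFamily_inst_mem {k n N : ℕ} (hN : 0 < N) (e : Fin k × Fin 5 ≃ Fin N)
    (θ : Fin k → (Fin n → Bool) × Fin n) (b : Fin k → Bool) :
    (pathFamily k n).inst hN e θ b ∈ agreement ↔ ∀ j, b j = HardFamily.correct θ j := by
  have hreads : ∀ p, ReadsOne ((pathFamily k n).inst hN e θ b) (e p) ↔
      ∃ q, (pathFamily k n).graph.Adj p q ∧
        ((pathFamily k n).label θ b q)[((pathFamily k n).label θ b p).length]? = some true := by
    intro p
    refine LabeledGraph.exists_ofEquiv.trans ?_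
    simp only [LabeledGraph.ofEquiv_adj, LabeledGraph.ofEquiv_label]
  have h1 : ∀ j, ReadsOne ((pathFamily k n).inst hN e θ b) (e (j, 1)) ↔
      HardFamily.correct θ j = true := by
    intro j
    rw [hreads]
    constructor
    · rintro ⟨⟨j', r⟩, ⟨h, h'⟩, h2⟩
      simp only at h
      subst h
      fin_cases r <;> simp [pathFamily, HardFamily.correct] at h' h2 ⊢
      exact h2
    · intro h
      exact ⟨(j, 0), ⟨rfl, by simp⟩, by simpa [pathFamily, HardFamily.correct] using h⟩
  have h3 : ∀ j, ReadsOne ((pathFamily k n).inst hN e θ b) (e (j, 3)) ↔ b j = true := by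
    intro j
    rw [hreads]
    constructor
    · rintro ⟨⟨j', r⟩, ⟨h, h'⟩, h2⟩
      simp only at h
      subst h
      fin_cases r <;> simp [pathFamily] at h' h2 ⊢
      exact h2
    · intro h
      exact ⟨(j, 4), ⟨rfl, by simp⟩, by simpa [pathFamily] using h⟩
  constructor
  · intro h j
    have := h (e (j, 2)) (e (j, 1)) (e (j, 3))
      (by rw [LabeledGraph.ofEquiv_label]; rfl)
      ((LabeledGraph.ofEquiv_adj hN e _ _ _ _).2 ⟨rfl, by simp⟩)
      ((LabeledGraph.ofEquiv_adj hN e _ _ _ _).2 ⟨rfl, by simp⟩)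
    rw [h1, h3] at this
    exact (Bool.eq_iff_iff.2 this).symm
  · intro h v w w' hv hw hw'
    obtain ⟨⟨j, r⟩, rfl⟩ := e.surjective v
    obtain ⟨⟨j₁, r₁⟩, rfl⟩ := e.surjective w
    obtain ⟨⟨j₂, r₂⟩, rfl⟩ := e.surjective w'
    rw [LabeledGraph.ofEquiv_label] at hv
    have hr : r = 2 := by
      fin_cases r <;> simp [pathFamily] at hv ⊢
    subst hr
    have key : ∀ j₁ r₁, (LabeledGraph.ofEquiv hN e (pathFamily k n).graph
        ((pathFamily k n).label θ b)).graph.Adj (e (j, 2)) (e (j₁, r₁)) →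
        (ReadsOne ((pathFamily k n).inst hN e θ b) (e (j₁, r₁)) ↔ b j = true) := by
      intro j₁ r₁ hw
      rw [LabeledGraph.ofEquiv_adj] at hw
      obtain ⟨hj, hw⟩ := hw
      simp only at hj
      subst hj
      fin_cases r₁ <;> simp at hw
      · exact (h1 j).trans (by rw [h])
      · exact h3 j
    exact (key _ _ hw).trans (key _ _ hw').symm

theorem agreement_notMem_RandCL {M : ℕ → ℕ} (hM : IsIdRange M) {ε : ℝ} (hε : 0 < ε) :
    agreement ∉ RandCL M (1 / 2 - ε) := by
  rintro ⟨Ω, _, μ, _, A, hmeas, ⟨c, hband⟩, hdec⟩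
  -- With `t = ε`, the bound `k (1 - 2δ) ≤ δ + k η` fails as soon as `k ε > 1` and the message term
  -- is below `1`.
  obtain ⟨k, hk⟩ := exists_nat_gt (1 / ε)
  have hkpos : 0 < k := by
    have : (0 : ℝ) < k := (by positivity : 0 < 1 / ε).trans hk
    exact_mod_cast this
  have hN : 0 < k * 5 := by omega
  set B : ℝ := ((c * Nat.log 2 (k * 5) : ℕ) : ℝ) with hB
  -- The network has `5 k` nodes whatever the length of the strings, so `n` can be chosen after the
  -- bandwidth `B`.
  obtain ⟨n, hn⟩ := exists_nat_gt (2 * k * B / ε)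
  have hB0 : 0 ≤ B := by positivity
  have hn0 : 0 < n := by
    have : (0 : ℝ) < n := (by positivity : 0 ≤ 2 * k * B / ε).trans_lt hn
    exact_mod_cast this
  have hnR : (0 : ℝ) < n := by exact_mod_cast hn0
  have key := (pathFamily k n).error_bound hN finProdFinEquiv (hM.1 _) (L := agreement) μ A hmeas
    hband hdec (fun j => ⟨rfl, by simp [pathFamily]⟩)
    (fun θ => (pathFamily_inst_mem _ _ _ _).2 fun _ => rfl)
    (fun θ j h => by
      have := (pathFamily_inst_mem _ _ _ _).1 h j
      simp [HardFamily.wrong, HardFamily.correct] at this) hn0 hε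
  rw [← hB] at key
  rw [div_lt_iff₀ hε] at hk hn
  have h1 : k * (2 * B / (ε * n)) < 1 := by
    rw [← mul_div_assoc, div_lt_one (by positivity)]
    linarith
  nlinarith

/-! ### The gadget -/

/-- A numbering of the nodes of the gadget. -/
def GadgetVertex.equivSum (n : ℕ) : GadgetVertex n ≃ Fin n ⊕ Fin 6 where
  toFun
    | .clique i => .inl i
    | .v₁ => .inr 0
    | .v₂ => .inr 1
    | .v₃ => .inr 2
    | .v₄ => .inr 3
    | .u₁ => .inr 4
    | .u₂ => .inr 5
  invFun
    | .inl i => .clique i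
    | .inr 0 => .v₁
    | .inr 1 => .v₂
    | .inr 2 => .v₃
    | .inr 3 => .v₄
    | .inr 4 => .u₁
    | .inr 5 => .u₂
  left_inv g := by cases g <;> rfl
  right_inv s := by
    rcases s with i | r
    · rfl
    · fin_cases r <;> rfl

instance (n : ℕ) : Fintype (GadgetVertex n) := Fintype.ofEquiv _ (GadgetVertex.equivSum n).symm

theorem GadgetVertex.card (n : ℕ) : Fintype.card (GadgetVertex n) = n + 6 := by
  rw [Fintype.card_congr (GadgetVertex.equivSum n)]
  simp

section Adj

variable {n : ℕ} {a : Fin n} {g : GadgetVertex n}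

theorem gadget_adj_v₁ : (gadget a).Adj .v₁ g ↔ g = .v₂ ∨ g = .u₁ ∨ g = .u₂ := by
  cases g <;> simp [gadget, gadgetRel]

theorem gadget_adj_v₂ : (gadget a).Adj .v₂ g ↔ g = .v₁ ∨ g = .v₃ := by
  cases g <;> simp [gadget, gadgetRel]

theorem gadget_adj_v₃ : (gadget a).Adj .v₃ g ↔ g = .v₂ ∨ g = .v₄ := by
  cases g <;> simp [gadget, gadgetRel]

theorem gadget_adj_v₄ : (gadget a).Adj .v₄ g ↔ g = .v₃ ∨ g = .clique a := by
  cases g <;> simp [gadget, gadgetRel]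

theorem gadget_adj_u₁ : (gadget a).Adj .u₁ g ↔ g = .v₁ := by
  cases g <;> simp [gadget, gadgetRel]

theorem gadget_adj_u₂ : (gadget a).Adj .u₂ g ↔ g = .v₁ := by
  cases g <;> simp [gadget, gadgetRel]

theorem gadget_adj_clique {i : Fin n} :
    (gadget a).Adj (.clique i) g ↔ (i = a ∧ g = .v₄) ∨ ∃ j, j ≠ i ∧ g = .clique j := by
  cases g <;> simp [gadget, gadgetRel, eq_comm]

end Adj

theorem labelCode_inj {s s' : Option (List Bool)} {r r' : Fin 5} :
    labelCode s r = labelCode s' r' ↔ s = s' ∧ r = r' := by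
  refine ⟨fun h => ?_, fun h => by rw [h.1, h.2]⟩
  have aux : ∀ (p q : ℕ) (l l' : List Bool), List.replicate p true ++ false :: l =
      List.replicate q true ++ false :: l' → p = q ∧ l = l' := by
    intro p
    induction p with
    | zero =>
      rintro (_ | q) l l' h
      · simpa using h
      · simp [List.replicate_succ] at h
    | succ p ih =>
      rintro (_ | q) l l' h
      · simp [List.replicate_succ] at h
      · simp only [List.replicate_succ, List.cons_append, List.cons.injEq, true_and] at h
        exact ⟨congrArg _ (ih q l l' h).1, (ih q l l' h).2⟩
  obtain ⟨h1, h2⟩ := aux _ _ _ _ h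
  refine ⟨?_, Fin.ext h1⟩
  cases s <;> cases s' <;> simp at h2 ⊢
  exact h2

section Label

variable {n : ℕ} {x y : Fin n → Bool} {b : Bool} {g : GadgetVertex n} {s : List Bool}

theorem gadgetLabel_eq_clique : gadgetLabel x y b g = labelCode none 0 ↔ ∃ i, g = .clique i := by
  cases g <;> simp [gadgetLabel, labelCode_inj]

theorem gadgetLabel_eq_v₁ : gadgetLabel x y b g = labelCode none 1 ↔ g = .v₁ := by
  cases g <;> simp [gadgetLabel, labelCode_inj]

theorem gadgetLabel_eq_v₂ : gadgetLabel x y b g = labelCode none 2 ↔ g = .v₂ := by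
  cases g <;> simp [gadgetLabel, labelCode_inj]

theorem gadgetLabel_eq_v₃ : gadgetLabel x y b g = labelCode none 3 ↔ g = .v₃ := by
  cases g <;> simp [gadgetLabel, labelCode_inj]

theorem gadgetLabel_eq_v₄ : gadgetLabel x y b g = labelCode (some s) 4 ↔ g = .v₄ ∧ s = [b] := by
  cases g <;> simp [gadgetLabel, labelCode_inj, eq_comm]

theorem gadgetLabel_eq_string : gadgetLabel x y b g = labelCode (some s) 0 ↔
    (g = .u₁ ∧ s = List.ofFn x) ∨ (g = .u₂ ∧ s = List.ofFn y) := by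
  cases g <;> simp [gadgetLabel, labelCode_inj, eq_comm]

end Label

/-! ### Conditions on labelled graphs that do not refer to an isomorphism -/

/-- Any two strings held by neighbors of `v` are disjoint. -/
def StringsDisjoint (I : LabeledGraph) (v : Fin I.order) : Prop :=
  ∀ w w', I.graph.Adj v w → I.graph.Adj v w' → w ≠ w' → ∀ s s' : List Bool,
    I.label w = labelCode (some s) 0 → I.label w' = labelCode (some s') 0 →
      ∀ i : ℕ, ¬ (s[i]? = some true ∧ s'[i]? = some true)

/-- Some neighbor of `v` holds the bit `1` and the rank `4`. -/
def StoresOne (I : LabeledGraph) (v : Fin I.order) : Prop :=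
  ∃ w, I.graph.Adj v w ∧ I.label w = labelCode (some [true]) 4

section Shape

variable {I : LabeledGraph} {n : ℕ} {a : Fin n} {x y : Fin n → Bool} {b : Bool}

/-- `I` is isomorphic to a gadget, with no condition on the bit `b`. -/
def IsGadget (I : LabeledGraph) : Prop :=
  ∃ (n : ℕ) (a : Fin n) (x y : Fin n → Bool) (b : Bool) (φ : I.graph ≃g gadget a),
    ∀ v, I.label v = gadgetLabel x y b (φ v)

theorem stringsDisjoint_iff (φ : I.graph ≃g gadget a)
    (hφ : ∀ v, I.label v = gadgetLabel x y b (φ v)) {v : Fin I.order}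
    (hv : I.label v = labelCode none 1) :
    StringsDisjoint I v ↔ ∀ i, ¬ (x i = true ∧ y i = true) := by
  rw [hφ, gadgetLabel_eq_v₁] at hv
  constructor
  · intro h i hi
    have hadj : ∀ g, (gadget a).Adj .v₁ g → I.graph.Adj v (φ.symm g) := fun g hg => by
      rw [← φ.map_adj_iff, hv]; simpa using hg
    refine h (φ.symm .u₁) (φ.symm .u₂) (hadj _ (gadget_adj_v₁.2 (by simp)))
      (hadj _ (gadget_adj_v₁.2 (by simp))) (by simp) (List.ofFn x) (List.ofFn y)
      (by rw [hφ, gadgetLabel_eq_string]; simp) (by rw [hφ, gadgetLabel_eq_string]; simp) i ?_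
    simpa using hi
  · rintro h w w' - - hne s s' hs hs' i ⟨hi, hi'⟩
    rw [hφ, gadgetLabel_eq_string] at hs hs'
    have hdis : ∀ s s' : List Bool, s = List.ofFn x → s' = List.ofFn y →
        s[i]? = some true → s'[i]? = some true → False := by
      rintro _ _ rfl rfl hi hi'
      obtain ⟨hlt, hxi⟩ := List.getElem?_eq_some_iff.1 hi
      obtain ⟨hlt', hyi⟩ := List.getElem?_eq_some_iff.1 hi'
      simp only [List.getElem_ofFn] at hxi hyi
      exact h _ ⟨hxi, hyi⟩
    rcases hs with ⟨hw, hs⟩ | ⟨hw, hs⟩ <;> rcases hs' with ⟨hw', hs'⟩ | ⟨hw', hs'⟩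
    · exact hne (φ.injective (hw.trans hw'.symm))
    · exact hdis _ _ hs hs' hi hi'
    · exact hdis _ _ hs' hs hi' hi
    · exact hne (φ.injective (hw.trans hw'.symm))

theorem storesOne_iff (φ : I.graph ≃g gadget a)
    (hφ : ∀ v, I.label v = gadgetLabel x y b (φ v)) {v : Fin I.order}
    (hv : I.label v = labelCode none 3) : StoresOne I v ↔ b = true := by
  rw [hφ, gadgetLabel_eq_v₃] at hv
  constructor
  · rintro ⟨w, -, hw⟩
    rw [hφ, gadgetLabel_eq_v₄] at hw
    simpa using hw.2.symm
  · intro h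
    refine ⟨φ.symm .v₄, ?_, ?_⟩
    · rw [← φ.map_adj_iff, hv]
      simp [gadget_adj_v₃]
    · rw [hφ, gadgetLabel_eq_v₄]
      simp [h]

/-- Whether a gadget is correct does not depend on the isomorphism. -/
theorem mem_specialDisjointness_iff (φ : I.graph ≃g gadget a)
    (hφ : ∀ v, I.label v = gadgetLabel x y b (φ v)) :
    I ∈ specialDisjointness ↔ (b = true ↔ ∀ i, ¬ (x i = true ∧ y i = true)) := by
  constructor
  · rintro ⟨n', a', x', y', b', φ', hφ', h⟩
    have h1 : I.label (φ.symm .v₁) = labelCode none 1 := by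
      rw [hφ, gadgetLabel_eq_v₁]; simp
    have h3 : I.label (φ.symm .v₃) = labelCode none 3 := by
      rw [hφ, gadgetLabel_eq_v₃]; simp
    -- Both sides of the equivalence are expressed by conditions on `I` itself, so they transfer
    -- from one isomorphism to the other.
    rw [← stringsDisjoint_iff φ hφ h1, ← storesOne_iff φ hφ h3, stringsDisjoint_iff φ' hφ' h1,
      storesOne_iff φ' hφ' h3]
    exact h
  · intro h
    exact ⟨n, a, x, y, b, φ, hφ, h⟩

end Shape

/-! ### The lower bound for `special-disjointness` -/

/-- The gadgets where `y` is the indicator of an index. -/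
def gadgetFamily {n : ℕ} (a : Fin n) : HardFamily (GadgetVertex n) 1 n where
  graph := gadget a
  label θ b := gadgetLabel (θ 0).1 (fun i => decide (i = (θ 0).2)) (b 0)
  comp _ := 0
  comp_eq_of_adj _ _ _ := rfl
  src _ := .u₁
  relay _ := .v₁
  tgt _ := .v₄
  comp_src _ := (Subsingleton.elim _ _)
  comp_tgt _ := (Subsingleton.elim _ _)
  eq_relay_of_adj _ _ h := gadget_adj_u₁.1 h
  label_src θ θ' b j h := by
    obtain rfl := Subsingleton.elim j 0
    simp [gadgetLabel, h]
  label_of_ne_src θ b j x x' i v hv := by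
    obtain rfl := Subsingleton.elim j 0
    cases v <;> simp [gadgetLabel] at hv ⊢
  label_of_ne_tgt θ b j c v hv := by
    cases v <;> simp [gadgetLabel] at hv ⊢
  far j v w w' hv hw hw' h := by
    subst h
    have hw₃ : w = .v₃ ∨ w = .v₄ ∨ w = .clique a := by
      rcases hw' with h | h
      · exact Or.inr (Or.inl h.symm)
      · rcases gadget_adj_v₄.1 h.symm with h | h
        · exact Or.inl h
        · exact Or.inr (Or.inr h)
    rcases hv with rfl | hv
    · rw [gadget_adj_u₁] at hw
      rcases hw₃ with rfl | rfl | rfl <;> simp at hw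
    · obtain rfl := gadget_adj_u₁.1 hv
      rw [gadget_adj_v₁] at hw
      rcases hw₃ with rfl | rfl | rfl <;> simp at hw

/-- A string is disjoint from the indicator of `i` exactly when its `i`-th bit is `0`. -/
theorem gadgetFamily_inst_mem {n N : ℕ} (a : Fin n) (hN : 0 < N) (e : GadgetVertex n ≃ Fin N)
    (θ : Fin 1 → (Fin n → Bool) × Fin n) (b : Fin 1 → Bool) :
    (gadgetFamily a).inst hN e θ b ∈ specialDisjointness ↔ b 0 = HardFamily.correct θ 0 := by
  let φ : ((gadgetFamily a).inst hN e θ b).graph ≃g gadget a :=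
    { toEquiv := e.symm, map_rel_iff' := Iff.rfl }
  rw [mem_specialDisjointness_iff φ (x := (θ 0).1) (y := fun i => decide (i = (θ 0).2))
    (b := b 0) fun v => rfl]
  refine Iff.trans (iff_congr Iff.rfl ?_) Bool.eq_iff_iff.symm
  simp only [HardFamily.correct, decide_eq_true_eq, Bool.not_eq_true', ← Bool.not_eq_true]
  exact ⟨fun h h' => h _ ⟨h', rfl⟩, fun h i hi => h (hi.2 ▸ hi.1)⟩

/-- Here the strings have length `n` in a network of `n + 6` nodes, so the bandwidth grows with `n`,
but only logarithmically. Taking `n + 6 = 2 ^ m` makes the logarithm exact, and `m² ≤ 2 ^ m`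
suffices. -/
theorem exists_log_lt (c : ℕ) {γ : ℝ} (hγ : 0 < γ) :
    ∃ n : ℕ, 0 < n ∧ (c * Nat.log 2 (n + 6) : ℕ) < γ * n := by
  obtain ⟨m, hm⟩ := exists_nat_gt (6 + c / γ)
  have hm6 : 6 < m := by
    have : (6 : ℝ) < m := lt_of_le_of_lt (le_add_of_nonneg_right (by positivity)) hm
    exact_mod_cast this
  have hsq : ∀ j : ℕ, (j + 4) ^ 2 ≤ 2 ^ (j + 4) := by
    intro j
    induction j with
    | zero => norm_num
    | succ j ih =>
      calc (j + 1 + 4) ^ 2 ≤ 2 * (j + 4) ^ 2 := by nlinarith [Nat.zero_le j, sq_nonneg j]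
        _ ≤ 2 * 2 ^ (j + 4) := Nat.mul_le_mul_left _ ih
        _ = 2 ^ (j + 1 + 4) := by ring
  have h1 : m ^ 2 ≤ 2 ^ m := by
    have := hsq (m - 4)
    rwa [Nat.sub_add_cancel (by omega)] at this
  have h2 : 6 < 2 ^ m := by nlinarith
  refine ⟨2 ^ m - 6, by omega, ?_⟩
  rw [Nat.sub_add_cancel h2.le, Nat.log_pow one_lt_two, Nat.cast_sub h2.le]
  have h3 : (c : ℝ) < γ * (m - 6) := by
    have : (c : ℝ) / γ < m - 6 := by linarith
    rwa [div_lt_iff₀ hγ, mul_comm] at this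
  have h4 : ((m : ℝ)) ^ 2 ≤ 2 ^ m := by exact_mod_cast h1
  have hm6' : (6 : ℝ) < m := by exact_mod_cast hm6
  push_cast
  have h5 : (c : ℝ) * m < γ * (m - 6) * m := mul_lt_mul_of_pos_right h3 (by linarith)
  have h6 : γ * (m - 6) * m ≤ γ * (2 ^ m - 6) := by
    rw [mul_assoc]
    exact mul_le_mul_of_nonneg_left (by nlinarith) hγ.le
  linarith

theorem specialDisjointness_notMem_RandCL {M : ℕ → ℕ} (hM : IsIdRange M) {δ : ℝ}
    (hδ : δ < 1 / 3) : specialDisjointness ∉ RandCL M δ := by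
  rintro ⟨Ω, _, μ, _, A, hmeas, ⟨c, hband⟩, hdec⟩
  set γ : ℝ := 1 - 3 * δ with hγ
  have hγ0 : 0 < γ := by linarith
  -- With one gadget and `t = γ` the bound reads `γ ≤ 2B / (γ n) + γ / 2`; the factor `γ² / 4` makes
  -- the first term less than `γ / 2`.
  obtain ⟨n, hn, hlog⟩ := exists_log_lt c (γ := γ ^ 2 / 4) (by positivity)
  have hnR : (0 : ℝ) < n := by exact_mod_cast hn
  have key := (gadgetFamily (⟨0, hn⟩ : Fin n)).error_bound (Nat.succ_pos (n + 5))
    ((GadgetVertex.equivSum n).trans finSumFinEquiv) (hM.1 _) (L := specialDisjointness) μ A hmeas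
    hband hdec (fun j => gadget_adj_u₁.2 rfl)
    (fun θ => (gadgetFamily_inst_mem _ _ _ _ _).2 rfl)
    (fun θ j h => by
      have := (gadgetFamily_inst_mem _ _ _ _ _).1 h
      obtain rfl := Subsingleton.elim j 0
      simp [HardFamily.wrong, HardFamily.correct] at this) hn hγ0
  have h1 : 2 * ((c * Nat.log 2 (n + 6) : ℕ) : ℝ) / (γ * n) < γ / 2 := by
    rw [div_lt_iff₀ (by positivity)]
    calc 2 * ((c * Nat.log 2 (n + 6) : ℕ) : ℝ) < 2 * (γ ^ 2 / 4 * n) := by linarith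
      _ = γ / 2 * (γ * n) := by ring
  simp only [Nat.cast_one, one_mul] at key
  have h2 : n + 5 + 1 = n + 6 := rfl
  rw [Nat.succ_eq_add_one, h2] at key
  linarith

/-! ### Recognizing gadgets locally -/

/-- `f` identifies the closed neighborhood of `g₀` in a gadget with that of `f g₀` in `I`. -/
structure IsLocalIso (I : LabeledGraph) {n : ℕ} (a : Fin n) (x y : Fin n → Bool) (b : Bool)
    (g₀ : GadgetVertex n) (f : GadgetVertex n → Fin I.order) : Prop where
  injOn : ∀ g g', g = g₀ ∨ (gadget a).Adj g₀ g → g' = g₀ ∨ (gadget a).Adj g₀ g' →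
    f g = f g' → g = g'
  label : ∀ g, g = g₀ ∨ (gadget a).Adj g₀ g → I.label (f g) = gadgetLabel x y b g
  surj : ∀ w, I.graph.Adj (f g₀) w → ∃ g, (gadget a).Adj g₀ g ∧ f g = w
  adj : ∀ g g', g = g₀ ∨ (gadget a).Adj g₀ g → g' = g₀ ∨ (gadget a).Adj g₀ g' →
    (I.graph.Adj (f g) (f g') ↔ (gadget a).Adj g g')
  closed : ∀ g, g = g₀ ∨ (gadget a).Adj g₀ g →
    ((∀ g', (gadget a).Adj g g' → g' = g₀ ∨ (gadget a).Adj g₀ g') ↔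
      ∀ w, I.graph.Adj (f g) w → w = f g₀ ∨ I.graph.Adj (f g₀) w)

namespace IsLocalIso

variable {I : LabeledGraph} {n : ℕ} {a : Fin n} {x y : Fin n → Bool} {b : Bool}
  {g₀ : GadgetVertex n} {f : GadgetVertex n → Fin I.order}

theorem adj_center_iff (h : IsLocalIso I a x y b g₀ f) (w : Fin I.order) :
    I.graph.Adj (f g₀) w ↔ ∃ g, (gadget a).Adj g₀ g ∧ f g = w := by
  refine ⟨h.surj w, ?_⟩
  rintro ⟨g, hg, rfl⟩
  exact (h.adj _ _ (Or.inl rfl) (Or.inr hg)).2 hg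

/-- The centre sees all the neighbours of such a node, and `closed` ensures that the node has no
others in `I`. -/
theorem adj_iff_of_closed (h : IsLocalIso I a x y b g₀ f) {g : GadgetVertex n}
    (hg : (gadget a).Adj g₀ g)
    (hc : ∀ g', (gadget a).Adj g g' → g' = g₀ ∨ (gadget a).Adj g₀ g') (w : Fin I.order) :
    I.graph.Adj (f g) w ↔ ∃ g', (gadget a).Adj g g' ∧ f g' = w := by
  constructor
  · intro hw
    rcases (h.closed g (Or.inr hg)).1 hc w hw with rfl | hw'
    · exact ⟨g₀, hg.symm, rfl⟩
    · obtain ⟨g', hg', rfl⟩ := h.surj w hw'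
      exact ⟨g', (h.adj _ _ (Or.inr hg) (Or.inr hg')).1 hw, rfl⟩
  · rintro ⟨g', hg', rfl⟩
    exact (h.adj _ _ (Or.inr hg) (hc _ hg')).2 hg'

end IsLocalIso

/-- The nodes of `I` cannot distinguish `I` from gadgets on their closed neighborhoods. -/
def LooksLikeGadget (I : LabeledGraph) (n : ℕ) : Prop :=
  ∀ v, ∃ (a : Fin n) (x y : Fin n → Bool) (b : Bool) (g₀ : GadgetVertex n)
    (f : GadgetVertex n → Fin I.order), f g₀ = v ∧ IsLocalIso I a x y b g₀ f

namespace LooksLikeGadget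

variable {I : LabeledGraph} {n : ℕ}

/-- The label tells which gadget vertex a node imitates, and hence its entire neighbourhood; the
next lemmas do the same for each rank. -/
theorem of_label_string (h : LooksLikeGadget I n) {v : Fin I.order} {s : List Bool}
    (hv : I.label v = labelCode (some s) 0) :
    ∃ p₁, I.label p₁ = labelCode none 1 ∧ ∀ w, I.graph.Adj v w ↔ w = p₁ := by
  obtain ⟨a, x, y, b, g₀, f, rfl, hf⟩ := h v
  have hadj := hf.adj_center_iff
  rw [hf.label _ (Or.inl rfl), gadgetLabel_eq_string] at hv
  rcases hv with ⟨rfl, -⟩ | ⟨rfl, -⟩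
  · refine ⟨f .v₁, ?_, fun w => ?_⟩
    · rw [hf.label _ (Or.inr (gadget_adj_u₁.2 rfl))]; rfl
    · rw [hadj]; simp [gadget_adj_u₁, eq_comm]
  · refine ⟨f .v₁, ?_, fun w => ?_⟩
    · rw [hf.label _ (Or.inr (gadget_adj_u₂.2 rfl))]; rfl
    · rw [hadj]; simp [gadget_adj_u₂, eq_comm]

theorem of_label_one (h : LooksLikeGadget I n) {v : Fin I.order}
    (hv : I.label v = labelCode none 1) :
    ∃ (p₂ w₁ w₂ : Fin I.order) (x y : Fin n → Bool), I.label p₂ = labelCode none 2 ∧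
      I.label w₁ = labelCode (some (List.ofFn x)) 0 ∧
      I.label w₂ = labelCode (some (List.ofFn y)) 0 ∧ w₁ ≠ w₂ ∧
      ∀ w, I.graph.Adj v w ↔ w = p₂ ∨ w = w₁ ∨ w = w₂ := by
  obtain ⟨a, x, y, b, g₀, f, rfl, hf⟩ := h v
  have hadj := hf.adj_center_iff
  rw [hf.label _ (Or.inl rfl), gadgetLabel_eq_v₁] at hv
  subst hv
  refine ⟨f .v₂, f .u₁, f .u₂, x, y, ?_, ?_, ?_, fun he => ?_, fun w => ?_⟩
  · rw [hf.label _ (Or.inr (gadget_adj_v₁.2 (by simp)))]; rfl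
  · rw [hf.label _ (Or.inr (gadget_adj_v₁.2 (by simp)))]; rfl
  · rw [hf.label _ (Or.inr (gadget_adj_v₁.2 (by simp)))]; rfl
  · have := hf.injOn _ _ (Or.inr (gadget_adj_v₁.2 (by simp)))
      (Or.inr (gadget_adj_v₁.2 (by simp))) he
    simp at this
  · rw [hadj]; simp [gadget_adj_v₁, eq_comm]

theorem of_label_two (h : LooksLikeGadget I n) {v : Fin I.order}
    (hv : I.label v = labelCode none 2) :
    ∃ p₁ p₃, I.label p₁ = labelCode none 1 ∧ I.label p₃ = labelCode none 3 ∧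
      ∀ w, I.graph.Adj v w ↔ w = p₁ ∨ w = p₃ := by
  obtain ⟨a, x, y, b, g₀, f, rfl, hf⟩ := h v
  have hadj := hf.adj_center_iff
  rw [hf.label _ (Or.inl rfl), gadgetLabel_eq_v₂] at hv
  subst hv
  refine ⟨f .v₁, f .v₃, ?_, ?_, fun w => ?_⟩
  · rw [hf.label _ (Or.inr (gadget_adj_v₂.2 (by simp)))]; rfl
  · rw [hf.label _ (Or.inr (gadget_adj_v₂.2 (by simp)))]; rfl
  · rw [hadj]; simp [gadget_adj_v₂, eq_comm]

theorem of_label_three (h : LooksLikeGadget I n) {v : Fin I.order}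
    (hv : I.label v = labelCode none 3) :
    ∃ (p₂ p₄ : Fin I.order) (b : Bool), I.label p₂ = labelCode none 2 ∧
      I.label p₄ = labelCode (some [b]) 4 ∧ ∀ w, I.graph.Adj v w ↔ w = p₂ ∨ w = p₄ := by
  obtain ⟨a, x, y, b, g₀, f, rfl, hf⟩ := h v
  have hadj := hf.adj_center_iff
  rw [hf.label _ (Or.inl rfl), gadgetLabel_eq_v₃] at hv
  subst hv
  refine ⟨f .v₂, f .v₄, b, ?_, ?_, fun w => ?_⟩
  · rw [hf.label _ (Or.inr (gadget_adj_v₃.2 (by simp)))]; rfl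
  · rw [hf.label _ (Or.inr (gadget_adj_v₃.2 (by simp)))]; rfl
  · rw [hadj]; simp [gadget_adj_v₃, eq_comm]

theorem of_label_four (h : LooksLikeGadget I n) {v : Fin I.order} {s : List Bool}
    (hv : I.label v = labelCode (some s) 4) :
    ∃ p₃ q, I.label p₃ = labelCode none 3 ∧ I.label q = labelCode none 0 ∧
      ∀ w, I.graph.Adj v w ↔ w = p₃ ∨ w = q := by
  obtain ⟨a, x, y, b, g₀, f, rfl, hf⟩ := h v
  have hadj := hf.adj_center_iff
  rw [hf.label _ (Or.inl rfl), gadgetLabel_eq_v₄] at hv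
  obtain ⟨rfl, -⟩ := hv
  refine ⟨f .v₃, f (.clique a), ?_, ?_, fun w => ?_⟩
  · rw [hf.label _ (Or.inr (gadget_adj_v₄.2 (by simp)))]; rfl
  · rw [hf.label _ (Or.inr (gadget_adj_v₄.2 (by simp)))]; rfl
  · rw [hadj]; simp [gadget_adj_v₄, eq_comm]

/-- A clique node with a neighbor of rank `4` sees the whole clique. -/
theorem of_label_clique (h : LooksLikeGadget I n) {v p₄ : Fin I.order} {s : List Bool}
    (hv : I.label v = labelCode none 0) (hp : I.label p₄ = labelCode (some s) 4)
    (hvp : I.graph.Adj v p₄) :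
    ∃ (K : Fin n → Fin I.order) (a : Fin n), Function.Injective K ∧ K a = v ∧
      (∀ i, I.label (K i) = labelCode none 0) ∧
      ∀ i w, I.graph.Adj (K i) w ↔ (i = a ∧ w = p₄) ∨ ∃ j, j ≠ i ∧ w = K j := by
  obtain ⟨a, x, y, b, g₀, f, rfl, hf⟩ := h v
  have hadj := hf.adj_center_iff
  rw [hf.label _ (Or.inl rfl), gadgetLabel_eq_clique] at hv
  obtain ⟨i₀, rfl⟩ := hv
  obtain ⟨g, hg, rfl⟩ := hf.surj _ hvp
  rw [hf.label _ (Or.inr hg), gadgetLabel_eq_v₄] at hp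
  obtain ⟨rfl, -⟩ := hp
  have hi : i₀ = a := by simpa [gadget_adj_clique] using hg
  subst hi
  have hnear : ∀ i, GadgetVertex.clique i = .clique i₀ ∨
      (gadget i₀).Adj (.clique i₀) (.clique i) := by
    intro i
    by_cases hi : i = i₀
    · exact Or.inl (congrArg _ hi)
    · exact Or.inr (gadget_adj_clique.2 (Or.inr ⟨i, hi, rfl⟩))
  refine ⟨fun i => f (.clique i), i₀, fun i j hij => ?_, rfl, fun i => ?_, fun i w => ?_⟩
  · simpa using hf.injOn _ _ (hnear i) (hnear j) hij
  · rw [hf.label _ (hnear i)]; rfl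
  · have key : I.graph.Adj (f (.clique i)) w ↔
        ∃ g', (gadget i₀).Adj (.clique i) g' ∧ f g' = w := by
      by_cases hi : i = i₀
      · subst hi; exact hadj w
      · refine hf.adj_iff_of_closed ((hnear i).resolve_left (by simpa using hi)) ?_ w
        intro g' hg'
        rw [gadget_adj_clique] at hg'
        rcases hg' with ⟨h, -⟩ | ⟨j, -, rfl⟩
        · exact absurd h hi
        · exact hnear j
    rw [key]
    constructor
    · rintro ⟨g', hg', rfl⟩
      rw [gadget_adj_clique] at hg'
      rcases hg' with ⟨h, rfl⟩ | ⟨j, hj, rfl⟩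
      · exact Or.inl ⟨h, rfl⟩
      · exact Or.inr ⟨j, hj, rfl⟩
    · rintro (⟨h, rfl⟩ | ⟨j, hj, rfl⟩)
      · exact ⟨.v₄, gadget_adj_clique.2 (Or.inl ⟨h, rfl⟩), rfl⟩
      · exact ⟨.clique j, gadget_adj_clique.2 (Or.inr ⟨j, hj, rfl⟩), rfl⟩

/-- A clique node that is not the attachment sees a clique neighbour with a neighbour out of sight.
In the view of that neighbour, the hidden node cannot be in the clique, so it has rank `4`. -/
theorem exists_label_four_of_clique (h : LooksLikeGadget I n) {v : Fin I.order}
    (hv : I.label v = labelCode none 0) :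
    ∃ (p₄ : Fin I.order) (b : Bool), I.label p₄ = labelCode (some [b]) 4 := by
  obtain ⟨a, x, y, b, g₀, f, rfl, hf⟩ := h v
  rw [hf.label _ (Or.inl rfl), gadgetLabel_eq_clique] at hv
  obtain ⟨i₀, rfl⟩ := hv
  by_cases hi : i₀ = a
  · subst hi
    refine ⟨f .v₄, b, ?_⟩
    rw [hf.label _ (Or.inr (gadget_adj_clique.2 (by simp)))]; rfl
  have hadj : (gadget a).Adj (.clique i₀) (.clique a) :=
    gadget_adj_clique.2 (Or.inr ⟨a, fun h => hi h.symm, rfl⟩)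
  -- the attachment node has a neighbor that is not visible from `v`
  have hopen : ¬ ∀ g', (gadget a).Adj (.clique a) g' →
      g' = .clique i₀ ∨ (gadget a).Adj (.clique i₀) g' := by
    intro hc
    have := hc .v₄ (gadget_adj_clique.2 (by simp))
    simp [gadget_adj_clique, hi] at this
  rw [hf.closed _ (Or.inr hadj)] at hopen
  push Not at hopen
  obtain ⟨w, hw, hwv, hvw⟩ := hopen
  have hql : I.label (f (.clique a)) = labelCode none 0 := hf.label _ (Or.inr hadj)
  have hvl : I.label (f (.clique i₀)) = labelCode none 0 := hf.label _ (Or.inl rfl)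
  have hvq : I.graph.Adj (f (.clique a)) (f (.clique i₀)) :=
    ((hf.adj _ _ (Or.inl rfl) (Or.inr hadj)).2 hadj).symm
  generalize f (.clique i₀) = v at *
  obtain ⟨a', x', y', b', g₁, f', hq, hf'⟩ := h (f (.clique a))
  rw [← hq] at hql hw hvq
  rw [hf'.label _ (Or.inl rfl), gadgetLabel_eq_clique] at hql
  obtain ⟨i₁, rfl⟩ := hql
  obtain ⟨g, hg, rfl⟩ := hf'.surj _ hvq
  obtain ⟨g', hg', rfl⟩ := hf'.surj _ hw
  rw [hf'.label _ (Or.inr hg), gadgetLabel_eq_clique] at hvl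
  obtain ⟨i₂, rfl⟩ := hvl
  rw [hf'.adj _ _ (Or.inr hg) (Or.inr hg')] at hvw
  have hg'' := hg'
  rw [gadget_adj_clique] at hg''
  rcases hg'' with ⟨-, rfl⟩ | ⟨j, -, rfl⟩
  · exact ⟨f' .v₄, b', hf'.label _ (Or.inr hg')⟩
  -- A hidden node in the clique would be adjacent to `v`.
  · refine absurd (gadget_adj_clique.2 (Or.inr ⟨j, ?_, rfl⟩)) hvw
    rintro rfl
    exact hwv rfl

/-- From any node, the ranks lead up to `4`. -/
theorem exists_label_four (h : LooksLikeGadget I n) :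
    ∃ (p₄ : Fin I.order) (b : Bool), I.label p₄ = labelCode (some [b]) 4 := by
  have h3 : ∀ v, I.label v = labelCode none 3 →
      ∃ (p₄ : Fin I.order) (b : Bool), I.label p₄ = labelCode (some [b]) 4 := by
    intro v hv
    obtain ⟨-, p₄, b, -, hp, -⟩ := h.of_label_three hv
    exact ⟨p₄, b, hp⟩
  have h2 : ∀ v, I.label v = labelCode none 2 →
      ∃ (p₄ : Fin I.order) (b : Bool), I.label p₄ = labelCode (some [b]) 4 := by
    intro v hv
    obtain ⟨-, p₃, -, hp, -⟩ := h.of_label_two hv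
    exact h3 p₃ hp
  have h1 : ∀ v, I.label v = labelCode none 1 →
      ∃ (p₄ : Fin I.order) (b : Bool), I.label p₄ = labelCode (some [b]) 4 := by
    intro v hv
    obtain ⟨p₂, -, -, -, -, hp, -⟩ := h.of_label_one hv
    exact h2 p₂ hp
  have hu : ∀ v s, I.label v = labelCode (some s) 0 →
      ∃ (p₄ : Fin I.order) (b : Bool), I.label p₄ = labelCode (some [b]) 4 := by
    intro v s hv
    obtain ⟨p₁, hp, -⟩ := h.of_label_string hv
    exact h1 p₁ hp
  obtain ⟨a, x, y, b, g₀, f, -, hf⟩ := h ⟨0, I.order_pos⟩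
  have hl := hf.label _ (Or.inl rfl)
  cases g₀ with
  | clique i => exact h.exists_label_four_of_clique hl
  | v₁ => exact h1 _ hl
  | v₂ => exact h2 _ hl
  | v₃ => exact h3 _ hl
  | v₄ => exact ⟨_, b, hl⟩
  | u₁ => exact hu _ _ hl
  | u₂ => exact hu _ _ hl

/-- Starting from a node of rank `4`, the local views unroll a whole gadget in which every node has
all its neighbours. Counting then excludes other nodes, including other components. -/
theorem isGadget (h : LooksLikeGadget I n) (hn : I.order = n + 6) : IsGadget I := by
  obtain ⟨p₄, b, hl₄⟩ := h.exists_label_four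
  obtain ⟨p₃, q, hl₃, hlq, hadj₄⟩ := h.of_label_four hl₄
  obtain ⟨K, a, hK, hKa, hlK, hadjK⟩ :=
    h.of_label_clique hlq hl₄ ((hadj₄ q).2 (Or.inr rfl)).symm
  obtain ⟨p₂, p₄', b', hl₂, hl₄', hadj₃⟩ := h.of_label_three hl₃
  have he₄ : p₄ = p₄' := by
    rcases (hadj₃ p₄).1 ((hadj₄ p₃).2 (Or.inl rfl)).symm with rfl | he
    · simp [hl₂, labelCode_inj] at hl₄
    · exact he
  subst he₄
  obtain ⟨p₁, p₃', hl₁, hl₃', hadj₂⟩ := h.of_label_two hl₂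
  have he₃ : p₃ = p₃' := by
    rcases (hadj₂ p₃).1 ((hadj₃ p₂).2 (Or.inl rfl)).symm with rfl | he
    · simp [hl₁, labelCode_inj] at hl₃
    · exact he
  subst he₃
  obtain ⟨p₂', w₁, w₂, x, y, hl₂', hlw₁, hlw₂, hne, hadj₁⟩ := h.of_label_one hl₁
  have he₂ : p₂ = p₂' := by
    rcases (hadj₁ p₂).1 ((hadj₂ p₁).2 (Or.inl rfl)).symm with he | rfl | rfl
    · exact he
    · simp [hl₂, labelCode_inj] at hlw₁
    · simp [hl₂, labelCode_inj] at hlw₂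
  subst he₂
  obtain ⟨p₁', -, hadjw₁⟩ := h.of_label_string hlw₁
  obtain rfl := (hadjw₁ p₁).1 ((hadj₁ w₁).2 (by simp)).symm
  obtain ⟨p₁', -, hadjw₂⟩ := h.of_label_string hlw₂
  obtain rfl := (hadjw₂ p₁).1 ((hadj₁ w₂).2 (by simp)).symm
  let ψ : GadgetVertex n → Fin I.order
    | .clique i => K i
    | .v₁ => p₁
    | .v₂ => p₂
    | .v₃ => p₃
    | .v₄ => p₄
    | .u₁ => w₁
    | .u₂ => w₂
  have hlabel : ∀ g, I.label (ψ g) = gadgetLabel x y b g := by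
    rintro (i | _) <;> first | exact hlK _ | assumption
  have hinj : Function.Injective ψ := by
    intro g g' he
    have hl : gadgetLabel x y b g = gadgetLabel x y b g' := by
      rw [← hlabel, ← hlabel, he]
    cases g <;> cases g' <;> simp [gadgetLabel, labelCode_inj] at hl ⊢
    · exact hK he
    · exact hne he
    · exact hne he.symm
  have hbij : Function.Bijective ψ := by
    rw [Fintype.bijective_iff_injective_and_card, GadgetVertex.card, Fintype.card_fin]
    exact ⟨hinj, hn.symm⟩
  have hadj : ∀ g w, I.graph.Adj (ψ g) w ↔ ∃ g', (gadget a).Adj g g' ∧ ψ g' = w := by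
    rintro (i | _) w
    · refine (hadjK i w).trans ?_
      simp only [gadget_adj_clique]
      constructor
      · rintro (⟨h, rfl⟩ | ⟨j, hj, rfl⟩)
        · exact ⟨.v₄, Or.inl ⟨h, rfl⟩, rfl⟩
        · exact ⟨.clique j, Or.inr ⟨j, hj, rfl⟩, rfl⟩
      · rintro ⟨g', ⟨h, rfl⟩ | ⟨j, hj, rfl⟩, rfl⟩
        · exact Or.inl ⟨h, rfl⟩
        · exact Or.inr ⟨j, hj, rfl⟩
    · refine (hadj₁ w).trans ?_
      simp [gadget_adj_v₁, ψ, eq_comm]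
    · refine (hadj₂ w).trans ?_
      simp [gadget_adj_v₂, ψ, eq_comm]
    · refine (hadj₃ w).trans ?_
      simp [gadget_adj_v₃, ψ, eq_comm]
    · refine (hadj₄ w).trans ?_
      simp [gadget_adj_v₄, ψ, eq_comm, hKa]
    · refine (hadjw₁ w).trans ?_
      simp [gadget_adj_u₁, ψ, eq_comm]
    · refine (hadjw₂ w).trans ?_
      simp [gadget_adj_u₂, ψ, eq_comm]
  have hiso : ∀ g g', I.graph.Adj (ψ g) (ψ g') ↔ (gadget a).Adj g g' := by
    intro g g'
    rw [hadj]
    constructor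
    · rintro ⟨g'', h1, h2⟩
      rwa [← hinj h2]
    · exact fun h => ⟨g', h, rfl⟩
  let φ : gadget a ≃g I.graph :=
    { toEquiv := Equiv.ofBijective ψ hbij, map_rel_iff' := hiso _ _ }
  refine ⟨n, a, x, y, b, φ.symm, fun v => ?_⟩
  obtain ⟨g, rfl⟩ := φ.surjective v
  rw [RelIso.symm_apply_apply]
  exact hlabel g

end LooksLikeGadget

/-! ### A deterministic algorithm for `special-disjointness` -/

theorem exists_injective_encoding : ∃ f : LocalInput → List Bool, Function.Injective f := by
  -- A unary code is affordable, since it is sent in the `LOCAL` round.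
  refine ⟨fun l => List.replicate (Encodable.encode (l.size, l.id, l.nbrs, l.label)) true,
    fun l l' h => ?_⟩
  have h1 := congrArg List.length h
  simp only [List.length_replicate, Encodable.encode_inj, Prod.mk.injEq] at h1
  cases l
  cases l'
  simpa using h1

/-- An injective encoding of the initial knowledge of a node. -/
noncomputable def encodeInput : LocalInput → List Bool := exists_injective_encoding.choose

theorem encodeInput_injective : Function.Injective encodeInput :=
  exists_injective_encoding.choose_spec

/-- The messages received by `v` when each node sends its initial knowledge. -/
noncomputable def inputInbox (I : LabeledGraph) (id : Fin I.order → ℕ) (v : Fin I.order) : Inbox :=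
  (neighbors I v).image fun w => (id w, encodeInput (localInput I id w))

/-- The node `v` has the same view as a node of a gadget. -/
def HasGadgetView (inp : LocalInput) (inbox : Inbox) : Prop :=
  ∃ (J : LabeledGraph) (id : Fin J.order → ℕ) (v : Fin J.order), IsGadget J ∧
    Function.Injective id ∧ localInput J id v = inp ∧ inputInbox J id v = inbox

/-- `StringsDisjoint`, read off the inbox of the first round. -/
def InboxStringsDisjoint (inbox : Inbox) : Prop :=
  ∀ p ∈ inbox, ∀ p' ∈ inbox, p.1 ≠ p'.1 → ∀ l l', p.2 = encodeInput l → p'.2 = encodeInput l' →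
    ∀ s s' : List Bool, l.label = labelCode (some s) 0 → l'.label = labelCode (some s') 0 →
      ∀ i : ℕ, ¬ (s[i]? = some true ∧ s'[i]? = some true)

/-- `StoresOne`, read off the inbox of the first round. -/
def InboxStoresOne (inbox : Inbox) : Prop :=
  ∃ p ∈ inbox, ∃ l, p.2 = encodeInput l ∧ l.label = labelCode (some [true]) 4

open Classical in
/-- Every node sends what it knows. Then `v₁` tells whether `x` and `y` are disjoint, `v₃` tells
the bit `b`, and `v₂` checks that they agree. All nodes check that they are in a gadget. -/
noncomputable def disjointnessAlgorithm : Algorithm where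
  send inp hist _ := match hist with
    | [] => encodeInput inp
    | inbox :: _ => [decide (if inp.label = labelCode none 1 then InboxStringsDisjoint inbox
        else InboxStoresOne inbox)]
  accept inp hist := match hist with
    | [inbox₂, inbox₁] => decide (HasGadgetView inp inbox₁ ∧
        (inp.label = labelCode none 2 → ∀ p ∈ inbox₂, ∀ p' ∈ inbox₂, p.2 = p'.2))
    | _ => true

section

variable {I : LabeledGraph} {id : Fin I.order → ℕ}

theorem inboxStringsDisjoint_iff (hid : Function.Injective id) (v : Fin I.order) :
    InboxStringsDisjoint (inputInbox I id v) ↔ StringsDisjoint I v := by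
  simp only [InboxStringsDisjoint, inputInbox, Finset.forall_mem_image, mem_neighbors,
    encodeInput_injective.eq_iff]
  constructor
  · intro h w w' hw hw' hne s s' hs hs'
    exact h hw hw' (hid.ne hne) _ _ rfl rfl s s' hs hs'
  · rintro h w hw w' hw' hne _ _ rfl rfl s s' hs hs'
    exact h w w' hw hw' (fun he => hne (congrArg id he)) s s' hs hs'

theorem inboxStoresOne_iff (v : Fin I.order) :
    InboxStoresOne (inputInbox I id v) ↔ StoresOne I v := by
  simp only [InboxStoresOne, inputInbox, Finset.exists_mem_image, mem_neighbors,
    encodeInput_injective.eq_iff, exists_eq_left']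
  rfl

theorem history_disjointnessAlgorithm_one (v : Fin I.order) :
    history disjointnessAlgorithm I id 1 v = [inputInbox I id v] := rfl

open Classical in
theorem message_disjointnessAlgorithm_one (hid : Function.Injective id) (v w : Fin I.order) :
    message disjointnessAlgorithm I id 1 v w =
      [decide (if I.label v = labelCode none 1 then StringsDisjoint I v else StoresOne I v)] := by
  rw [message, history_disjointnessAlgorithm_one, ← inboxStringsDisjoint_iff hid v,
    ← inboxStoresOne_iff (id := id) v]
  rfl

theorem nodeAccepts_disjointnessAlgorithm (v : Fin I.order) :
    NodeAccepts disjointnessAlgorithm I id 2 v ↔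
      HasGadgetView (localInput I id v) (inputInbox I id v) ∧
        (I.label v = labelCode none 2 → ∀ w, I.graph.Adj v w → ∀ w', I.graph.Adj v w' →
          message disjointnessAlgorithm I id 1 w v = message disjointnessAlgorithm I id 1 w' v) := by
  classical
  rw [NodeAccepts, history_succ, history_disjointnessAlgorithm_one]
  refine decide_eq_true_iff.trans (and_congr Iff.rfl (imp_congr Iff.rfl ?_))
  simp only [Finset.forall_mem_image, mem_neighbors]

/-- Identifiers glue the two graphs: a vertex near the centre of the gadget is sent to the node of
`I` with the same identifier. Equal inputs give equal sets of neighbour identifiers, and injectivity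
turns these into equal adjacencies. -/
theorem HasGadgetView.exists_isLocalIso (hid : Function.Injective id) {v : Fin I.order}
    (h : HasGadgetView (localInput I id v) (inputInbox I id v)) :
    ∃ (n : ℕ) (a : Fin n) (x y : Fin n → Bool) (b : Bool) (g₀ : GadgetVertex n)
      (f : GadgetVertex n → Fin I.order), I.order = n + 6 ∧ f g₀ = v ∧
        IsLocalIso I a x y b g₀ f := by
  obtain ⟨J, id', v', ⟨n, a, x, y, b, φ, hφ⟩, hid', hinp, hinbox⟩ := h
  -- The number of nodes is part of the view, which fixes `n`.
  have horder : I.order = n + 6 := by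
    have h1 : J.order = I.order := congrArg LocalInput.size hinp
    have h2 := Fintype.card_congr φ.toEquiv
    rw [GadgetVertex.card, Fintype.card_fin] at h2
    omega
  have hmatch : ∀ g, ∃ w, g = φ v' ∨ (gadget a).Adj (φ v') g →
      id w = id' (φ.symm g) ∧ localInput I id w = localInput J id' (φ.symm g) := by
    intro g
    by_cases hg : g = φ v' ∨ (gadget a).Adj (φ v') g
    · rcases hg with rfl | hg
      · refine ⟨v, fun _ => ?_⟩
        rw [RelIso.symm_apply_apply, hinp]
        exact ⟨(congrArg LocalInput.id hinp).symm, rfl⟩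
      · have hmem : (id' (φ.symm g), encodeInput (localInput J id' (φ.symm g))) ∈
            inputInbox J id' v' := by
          refine Finset.mem_image_of_mem _ (mem_neighbors.2 ?_)
          rw [← φ.map_adj_iff, RelIso.apply_symm_apply]
          exact hg
        rw [hinbox] at hmem
        obtain ⟨w, -, hw⟩ := Finset.mem_image.1 hmem
        rw [Prod.mk.injEq] at hw
        exact ⟨w, fun _ => ⟨hw.1, encodeInput_injective hw.2⟩⟩
    -- Away from the closed neighbourhood the value is irrelevant.
    · exact ⟨v, fun h => absurd h hg⟩
  choose f hf using hmatch
  have hcenter : f (φ v') = v := by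
    apply hid
    rw [(hf _ (Or.inl rfl)).1, RelIso.symm_apply_apply]
    exact congrArg LocalInput.id hinp
  have hidg : ∀ g g', id' (φ.symm g) = id' (φ.symm g') → g = g' := fun g g' h =>
    φ.symm.injective (hid' h)
  have hnbrs : ∀ g, g = φ v' ∨ (gadget a).Adj (φ v') g →
      (neighbors I (f g)).image id = (neighbors J (φ.symm g)).image id' := fun g hg =>
    congrArg LocalInput.nbrs (hf g hg).2
  have hback : ∀ g, g = φ v' ∨ (gadget a).Adj (φ v') g → ∀ w, I.graph.Adj (f g) w →
      ∃ g', (gadget a).Adj g g' ∧ id w = id' (φ.symm g') := by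
    intro g hg w hw
    have hmem := Finset.mem_image_of_mem id (mem_neighbors.2 hw)
    rw [hnbrs g hg] at hmem
    obtain ⟨u, hu, he⟩ := Finset.mem_image.1 hmem
    refine ⟨φ u, ?_, by rw [RelIso.symm_apply_apply, he]⟩
    rw [mem_neighbors, ← φ.map_adj_iff, RelIso.apply_symm_apply] at hu
    exact hu
  have hforth : ∀ g, g = φ v' ∨ (gadget a).Adj (φ v') g → ∀ g', (gadget a).Adj g g' →
      ∃ w, I.graph.Adj (f g) w ∧ id w = id' (φ.symm g') := by
    intro g hg g' hg'
    have hmem : id' (φ.symm g') ∈ (neighbors J (φ.symm g)).image id' := by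
      refine Finset.mem_image_of_mem _ (mem_neighbors.2 ?_)
      rwa [← φ.map_adj_iff, RelIso.apply_symm_apply, RelIso.apply_symm_apply]
    rw [← hnbrs g hg] at hmem
    obtain ⟨w, hw, he⟩ := Finset.mem_image.1 hmem
    exact ⟨w, mem_neighbors.1 hw, he⟩
  have hadj : ∀ g g', g = φ v' ∨ (gadget a).Adj (φ v') g → g' = φ v' ∨ (gadget a).Adj (φ v') g' →
      (I.graph.Adj (f g) (f g') ↔ (gadget a).Adj g g') := by
    intro g g' hg hg'
    constructor
    · intro h
      obtain ⟨g'', h1, h2⟩ := hback g hg _ h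
      rw [(hf g' hg').1] at h2
      rwa [hidg _ _ h2]
    · intro h
      obtain ⟨w, h1, h2⟩ := hforth g hg _ h
      rw [← (hf g' hg').1] at h2
      rwa [← hid h2]
  have hsurj : ∀ w, I.graph.Adj (f (φ v')) w → ∃ g, (gadget a).Adj (φ v') g ∧ f g = w := by
    intro w hw
    obtain ⟨g, hg, he⟩ := hback _ (Or.inl rfl) w hw
    exact ⟨g, hg, hid ((hf g (Or.inr hg)).1.trans he.symm)⟩
  refine ⟨n, a, x, y, b, φ v', f, horder, hcenter, ?_, ?_, hsurj, hadj, ?_⟩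
  · intro g g' hg hg' he
    refine hidg _ _ ?_
    rw [← (hf g hg).1, ← (hf g' hg').1, he]
  · intro g hg
    have h1 : I.label (f g) = J.label (φ.symm g) := congrArg LocalInput.label (hf g hg).2
    rw [h1, hφ, RelIso.apply_symm_apply]
  · intro g hg
    constructor
    · intro hc w hw
      obtain ⟨g', hg', he⟩ := hback g hg w hw
      have hnear := hc g' hg'
      obtain rfl : f g' = w := hid ((hf g' hnear).1.trans he.symm)
      rcases hnear with rfl | hnear
      · exact Or.inl rfl
      · exact Or.inr ((hadj _ _ (Or.inl rfl) (Or.inr hnear)).2 hnear)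
    · intro hc g' hg'
      obtain ⟨w, hw, he⟩ := hforth g hg g' hg'
      rcases hc w hw with rfl | hw'
      · left
        rw [(hf _ (Or.inl rfl)).1] at he
        exact (hidg _ _ he).symm
      · obtain ⟨g'', hg'', rfl⟩ := hsurj w hw'
        rw [(hf _ (Or.inr hg'')).1] at he
        rw [← hidg _ _ he]
        exact Or.inr hg''

theorem isGadget_of_hasGadgetView (hid : Function.Injective id)
    (h : ∀ v, HasGadgetView (localInput I id v) (inputInbox I id v)) : IsGadget I := by
  obtain ⟨n, -, -, -, -, -, -, hn, -⟩ := (h ⟨0, I.order_pos⟩).exists_isLocalIso hid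
  refine LooksLikeGadget.isGadget (n := n) (fun v => ?_) hn
  obtain ⟨n', a, x, y, b, g₀, f, hn', hf⟩ := (h v).exists_isLocalIso hid
  obtain rfl : n' = n := by omega
  exact ⟨a, x, y, b, g₀, f, hf⟩

end

theorem specialDisjointness_mem_LC (M : ℕ → ℕ) : specialDisjointness ∈ LC M := by
  classical
  refine ⟨disjointnessAlgorithm, ⟨1, fun I id hid t ht v w hvw => ?_⟩, fun I id hid => ?_⟩
  · obtain rfl : t = 1 := by
      rcases t with _ | _ | t <;> simp at ht ⊢
    rw [message_disjointnessAlgorithm_one hid.1, one_mul]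
    exact one_le_log_order hvw
  have hacc : AllAccept disjointnessAlgorithm I id 2 ↔ IsGadget I ∧
      ∀ v, I.label v = labelCode none 2 → ∀ w, I.graph.Adj v w → ∀ w', I.graph.Adj v w' →
        message disjointnessAlgorithm I id 1 w v = message disjointnessAlgorithm I id 1 w' v := by
    refine (forall_congr' nodeAccepts_disjointnessAlgorithm).trans (forall_and.trans ?_)
    refine and_congr ⟨isGadget_of_hasGadgetView hid.1, fun h v => ?_⟩ Iff.rfl
    -- A gadget is its own witness for the views of its nodes.
    exact ⟨I, id, v, h, hid.1, rfl, rfl⟩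
  refine Iff.trans ?_ hacc.symm
  simp only [message_disjointnessAlgorithm_one hid.1, List.cons.injEq, and_true, decide_eq_decide]
  constructor
  · intro h
    obtain ⟨n, a, x, y, b, φ, hφ, hb⟩ := h
    refine ⟨⟨n, a, x, y, b, φ, hφ⟩, fun v hv => ?_⟩
    rw [hφ, gadgetLabel_eq_v₂] at hv
    have key : ∀ w, I.graph.Adj v w →
        ((if I.label w = labelCode none 1 then StringsDisjoint I w else StoresOne I w) ↔
          b = true) := by
      intro w hw
      rw [← φ.map_adj_iff, hv, gadget_adj_v₂] at hw
      rcases hw with hw | hw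
      · have hl : I.label w = labelCode none 1 := by rw [hφ, hw]; rfl
        rw [if_pos hl, stringsDisjoint_iff φ hφ hl, hb]
      · have hl : I.label w = labelCode none 3 := by rw [hφ, hw]; rfl
        rw [if_neg (by simp [hl, labelCode_inj]), storesOne_iff φ hφ hl]
    intro w hw w' hw'
    rw [key w hw, key w' hw']
  · rintro ⟨⟨n, a, x, y, b, φ, hφ⟩, h⟩
    have hl : ∀ g, I.label (φ.symm g) = gadgetLabel x y b g := fun g => by rw [hφ]; simp
    have h1 : I.label (φ.symm .v₁) = labelCode none 1 := hl _
    have h3 : I.label (φ.symm .v₃) = labelCode none 3 := hl _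
    have := h (φ.symm .v₂) (hl _) (φ.symm .v₁) (φ.symm.map_adj_iff.2 (gadget_adj_v₂.2 (by simp)))
      (φ.symm .v₃) (φ.symm.map_adj_iff.2 (gadget_adj_v₂.2 (by simp)))
    rw [if_pos h1, if_neg (by simp [h3, labelCode_inj]), stringsDisjoint_iff φ hφ h1,
      storesOne_iff φ hφ h3] at this
    exact ⟨n, a, x, y, b, φ, hφ, this.symm⟩

/-- Deterministic algorithms are ruled out by the bounds for randomized ones. -/
theorem notMem_CL_of_notMem_RandCL {M : ℕ → ℕ} {L : DistLanguage} {δ : ℝ} (hδ : 0 ≤ δ)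
    (h : L ∉ RandCL M δ) : L ∉ CL M :=
  fun h' => h (decidable_subset_randDecidable M _ hδ h')

end HybridModels

/-! ### The two separations -/

theorem mainTheorem10 :
    (∀ M : ℕ → ℕ, HybridModels.IsIdRange M →
      HybridModels.specialDisjointness ∈ HybridModels.LC M \ HybridModels.CL M ∧
      ∀ δ : ℝ, δ < 1 / 3 → HybridModels.specialDisjointness ∉ HybridModels.RandCL M δ) ∧
    ∃ L : HybridModels.DistLanguage, ∀ M : ℕ → ℕ, HybridModels.IsIdRange M →
      L ∈ HybridModels.LC M \ HybridModels.CL M ∧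
      ∀ ε : ℝ, 0 < ε → L ∉ HybridModels.RandCL M (1 / 2 - ε) := by
  refine ⟨fun M hM => ⟨⟨HybridModels.specialDisjointness_mem_LC M, ?_⟩, fun δ hδ =>
    HybridModels.specialDisjointness_notMem_RandCL hM hδ⟩,
    HybridModels.agreement, fun M hM => ⟨⟨HybridModels.agreement_mem_LC M, ?_⟩, fun ε hε =>
    HybridModels.agreement_notMem_RandCL hM hε⟩⟩
  · exact HybridModels.notMem_CL_of_notMem_RandCL le_rfl
      (HybridModels.specialDisjointness_notMem_RandCL hM (by norm_num))
  · exact HybridModels.notMem_CL_of_notMem_RandCL (δ := 1 / 2 - 1 / 4) (by norm_num)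
      (HybridModels.agreement_notMem_RandCL hM (by norm_num))
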